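/- Let $\mathbb D=\{|z|<1\}$. For $\Omega\subset\mathbb C$ and $d\ge 0$ let $\mathrm{Div}_d(\Omega)$ be the set of integral (effective) divisors of degree $d$ on $\Omega$, with the quotient topology of the map $\Omega^d\to\mathrm{Div}_d(\Omega)$, $(z_1,\dots,z_d)\mapsto\sum_k 1\cdot z_k$. Fix an integer $m\ge 1$. For $Z=\sum_{k=1}^d 1\cdot a_k\in\mathrm{Div}_d(\mathbb D)$ let $$f_Z(z)=z^m\prod_{k=1}^d\left(\frac{1-\overline{a_k}}{1-a_k}\cdot\frac{z-a_k}{1-\overline{a_k}z}\right)$$ be the Blaschke product with free zero divisor $Z$, and define its free ramification divisor $R_{f_Z}$ by $$\sum_{q\in\mathbb D}(\deg(f_Z,q)-1)\cdot q=(m-1)\cdot 0+R_{f_Z},$$ where $\deg(f,q)$ is the multiplicity of $q$ as a zero of $f(z)-f(q)$. For every $d\ge0$, $R_{f_Z}\in\mathrm{Div}_d(\mathbb D)$ for all $Z\in \mathrm{Div}_d(\mathbb D)$, and $\Psi_{d,m}:\mathrm{Div}_d(\mathbb D)\to\mathrm{Div}_d(\mathbb D)$, $Z\mapsto R_{f_Z}$,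 is a homeomorphism (Heins, Zakeri). For every $e\ge 1$, the map $\Psi_{e,m}$ extends to a homeomorphism $$\Phi_{e,m}:\mathrm{Div}_e(\overline{\mathbb D})\to\mathrm{Div}_e(\overline{\mathbb D}),$$ and whenever $d_1+d_2=e$ with $d_1\ge 0$, $d_2\ge1$, $D_1\in\mathrm{Div}_{d_1}(\mathbb D)$ and $D_2\in\mathrm{Div}_{d_2}(\partial\mathbb D)$, $$\Phi_{e,m}(D_1+D_2)=\Psi_{d_1,m}(D_1)+D_2.$$ -/

import Mathlib

/-- The open unit disk. -/
def openDisk : Set ℂ := Metric.ball 0 1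

/-- The closed unit disk. -/
def closedDisk : Set ℂ := Metric.closedBall 0 1

/-- The unit circle. -/
def unitCircle : Set ℂ := Metric.sphere 0 1

/-- `IntegralDiv Ω e` is the set of integral (effective) divisors of degree `e` on `Ω ⊆ ℂ`.
An integral divisor `∑ ν(q) · q` is recorded as the multiset in which each `q` occurs
`ν(q)` times. -/
@[ext]
structure IntegralDiv (Ω : Set ℂ) (e : ℕ) where
  points : Multiset ℂ
  mem_of_mem : ∀ q ∈ points, q ∈ Ω
  card_eq : Multiset.card points = e

namespace IntegralDiv

/-- The map `Ω ^ e → Div_e(Ω)` sending `(z₁, …, z_e)` to `1 · z₁ + ⋯ + 1 · z_e`. -/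
def ofTuple (Ω : Set ℂ) (e : ℕ) (z : Fin e → Ω) : IntegralDiv Ω e where
  points := (Finset.univ : Finset (Fin e)).val.map fun k => (z k : ℂ)
  mem_of_mem := by
    intro q hq
    obtain ⟨k, -, rfl⟩ := Multiset.mem_map.1 hq
    exact (z k).2
  card_eq := by simp

/-- The quotient topology of `Ω ^ e → Div_e(Ω)`. -/
noncomputable instance (Ω : Set ℂ) (e : ℕ) : TopologicalSpace (IntegralDiv Ω e) :=
  TopologicalSpace.coinduced (ofTuple Ω e) inferInstance

/-- The inclusion of divisors on the open disk into divisors on the closed disk. -/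
def toClosed {e : ℕ} (D : IntegralDiv openDisk e) : IntegralDiv closedDisk e where
  points := D.points
  mem_of_mem q hq := Metric.ball_subset_closedBall (D.mem_of_mem q hq)
  card_eq := D.card_eq

/-- The sum `D₁ + D₂`, as a divisor on the closed disk, of a divisor `D₁` on the open disk
and a divisor `D₂` on the unit circle. -/
def sum {d₁ d₂ e : ℕ} (h : d₁ + d₂ = e) (D₁ : IntegralDiv openDisk d₁)
    (D₂ : IntegralDiv unitCircle d₂) : IntegralDiv closedDisk e where
  points := D₁.points + D₂.points
  mem_of_mem q hq := by
    rcases Multiset.mem_add.1 hq with hq | hq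
    · exact Metric.ball_subset_closedBall (D₁.mem_of_mem q hq)
    · exact Metric.sphere_subset_closedBall (D₂.mem_of_mem q hq)
  card_eq := by rw [Multiset.card_add, D₁.card_eq, D₂.card_eq, h]

open Classical in
/-- The coefficient `ν(q)` of `q` in an integral divisor. -/
noncomputable def mult {Ω : Set ℂ} {e : ℕ} (D : IntegralDiv Ω e) (q : ℂ) : ℤ :=
  (D.points.count q : ℤ)

end IntegralDiv

/-- The Blaschke product
`z ↦ z ^ m * ∏ₖ ((1 - conj aₖ) / (1 - aₖ)) * ((z - aₖ) / (1 - conj aₖ * z))`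
with free zero divisor `Z = ∑ₖ 1 · aₖ`. -/
noncomputable def blaschke (m : ℕ) {e : ℕ} (Z : IntegralDiv openDisk e) (z : ℂ) : ℂ :=
  z ^ m * (Z.points.map fun a =>
    (1 - starRingEnd ℂ a) / (1 - a) * ((z - a) / (1 - starRingEnd ℂ a * z))).prod

/-- The local degree of `f` at `q`: the multiplicity of `q` as a zero of `f(z) - f(q)`. -/
noncomputable def localDegree (f : ℂ → ℂ) (q : ℂ) : ℕ :=
  analyticOrderNatAt (fun z => f z - f q) q

open Classical in
/-- The coefficients of the ramification divisor
`R(f) = ∑ (deg(f, q) - 1) · q`, the sum being over `q` in the open disk. -/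
noncomputable def ramification (f : ℂ → ℂ) (q : ℂ) : ℤ :=
  if q ∈ openDisk then (localDegree f q : ℤ) - 1 else 0

open Classical in
/-- The coefficients of the free ramification divisor `R_f`, where `R(f) = (m - 1) · 0 + R_f`. -/
noncomputable def freeRamification (m : ℕ) (f : ℂ → ℂ) (q : ℂ) : ℤ :=
  ramification f q - if q = 0 then (m : ℤ) - 1 else 0

/-! ### The zero, pole and critical polynomials of a finite Blaschke product. -/

section Polynomials

open Polynomial ComplexConjugate

/-! Up to a unimodular constant the Blaschke product is f = z^m P/Q with P = `zeroPoly S` and Q =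
`polePoly S`, and f' equals z^(m-1) `critPoly m S` / Q² up to the same constant. On the unit circle
`critPoly m S` is z^d times a positive function, so by Fejér–Riesz (`exists_eq_C_mul_symPoly`) it is
a constant times `symPoly T` for a unique T in the disk: T is the free ramification divisor.

The relation `IsCritDiv` (`critPoly m S` is proportional to `symPoly T`) still makes sense when
points lie on the circle. A zero b there has a constant Blaschke factor, and it multiplies both
polynomials by `symPoly {b}`. So the relation is unchanged by adding a circle divisor to both sides,
which is the formula for Φ and reduces bijectivity on the closed disk to bijectivity on the open
one.

Injectivity on the open disk: the metrics |f'|/(1 - |f|²) have curvature -4. If two products have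
the same critical divisor, a maximum principle (`defect_le`) shows that |Q|² - |P|² agrees for both
up to a positive constant. Polarization at the origin, where P vanishes because m ≥ 1, then recovers
Q and hence S.

Surjectivity is a continuity argument along t ↦ tT. In the 2d+1 real coefficients of a positive
multiple of P, the critical polynomial is a quadratic map into a space of the same dimension. A
quadratic map injective on an open set is a local homeomorphism (`map_nhds_eq_of_quadratic_injOn`),
so the attained parameters form an open set; compactness of divisors on the closed disk makes it
closed.

Continuity in both directions holds because the graph of Φ is cut out by closed conditions in a
product of compact spaces. The statement for Ψ follows by restriction along an open embedding. -/

/-- The monic polynomial `∏ (X - a)` with zeros the points of `S`. -/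
noncomputable def zeroPoly (S : Multiset ℂ) : ℂ[X] :=
  (S.map fun a => X - C a).prod

/-- The reversed polynomial `∏ (1 - conj a * X)`. -/
noncomputable def polePoly (S : Multiset ℂ) : ℂ[X] :=
  (S.map fun a => 1 - C (conj a) * X).prod

/-- The self-inversive polynomial `∏ (X - a) * (1 - conj a * X)`. -/
noncomputable def symPoly (S : Multiset ℂ) : ℂ[X] :=
  zeroPoly S * polePoly S

/-- The numerator of the derivative of `z ^ m * zeroPoly S / polePoly S`, divided by `z ^ (m - 1)`. -/
noncomputable def critPoly (m : ℕ) (S : Multiset ℂ) : ℂ[X] :=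
  C (m : ℂ) * (zeroPoly S * polePoly S) +
    X * (derivative (zeroPoly S) * polePoly S - zeroPoly S * derivative (polePoly S))

@[simp] theorem zeroPoly_zero : zeroPoly 0 = 1 := by simp [zeroPoly]
@[simp] theorem polePoly_zero : polePoly 0 = 1 := by simp [polePoly]
@[simp] theorem symPoly_zero : symPoly 0 = 1 := by simp [symPoly]
@[simp] theorem critPoly_zero (m : ℕ) : critPoly m 0 = C (m : ℂ) := by simp [critPoly]

theorem zeroPoly_cons (a : ℂ) (S : Multiset ℂ) :
    zeroPoly (a ::ₘ S) = (X - C a) * zeroPoly S := by simp [zeroPoly]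

theorem polePoly_cons (a : ℂ) (S : Multiset ℂ) :
    polePoly (a ::ₘ S) = (1 - C (conj a) * X) * polePoly S := by simp [polePoly]

theorem symPoly_cons (a : ℂ) (S : Multiset ℂ) :
    symPoly (a ::ₘ S) = ((X - C a) * (1 - C (conj a) * X)) * symPoly S := by
  simp only [symPoly, zeroPoly_cons, polePoly_cons]; ring

theorem symPoly_add (S T : Multiset ℂ) : symPoly (S + T) = symPoly S * symPoly T := by
  simp only [symPoly, zeroPoly, polePoly, Multiset.map_add, Multiset.prod_add]; ring

/-- This is z f'/f = m + ∑ z(1 - |a|²)/((z - a)(1 - conj a · z)) cleared of denominators: each zero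
adds one summand. -/
theorem critPoly_cons (m : ℕ) (a : ℂ) (S : Multiset ℂ) :
    critPoly m (a ::ₘ S) = ((X - C a) * (1 - C (conj a) * X)) * critPoly m S +
      X * C (1 - a * conj a) * symPoly S := by
  simp only [critPoly, symPoly, zeroPoly_cons, polePoly_cons, derivative_mul,
    derivative_X, derivative_C, derivative_one, map_sub, map_mul, map_one]
  ring

/-- The inhomogeneous term of `critPoly_cons` carries the factor 1 - |b|², which vanishes on the
circle. -/
theorem critPoly_add_of_mem_circle (m : ℕ) (S B : Multiset ℂ) (hB : ∀ b ∈ B, ‖b‖ = 1) :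
    critPoly m (S + B) = symPoly B * critPoly m S := by
  induction B using Multiset.induction_on with
  | empty => simp
  | cons b B ih =>
    have hb : 1 - b * conj b = 0 := by
      rw [Complex.mul_conj, Complex.normSq_eq_norm_sq, hB b (Multiset.mem_cons_self b B)]; simp
    rw [Multiset.add_cons, critPoly_cons, ih fun c hc => hB c (Multiset.mem_cons_of_mem hc),
      symPoly_cons, hb]
    simp only [map_zero, mul_zero, zero_mul, add_zero]
    ring

theorem zeroPoly_ne_zero (S : Multiset ℂ) : zeroPoly S ≠ 0 :=
  (monic_multiset_prod_of_monic _ _ fun a _ => monic_X_sub_C a).ne_zero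

theorem natDegree_zeroPoly (S : Multiset ℂ) : (zeroPoly S).natDegree = Multiset.card S := by
  simp [zeroPoly]

theorem roots_zeroPoly (S : Multiset ℂ) : (zeroPoly S).roots = S :=
  roots_multiset_prod_X_sub_C S

theorem natDegree_polePoly_le (S : Multiset ℂ) : (polePoly S).natDegree ≤ Multiset.card S := by
  induction S using Multiset.induction_on with
  | empty => simp
  | cons a S ih =>
    rw [polePoly_cons, Multiset.card_cons, add_comm]
    refine natDegree_mul_le.trans (add_le_add ?_ ih)
    compute_degree

theorem natDegree_symPoly_le (S : Multiset ℂ) : (symPoly S).natDegree ≤ 2 * Multiset.card S := by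
  refine natDegree_mul_le.trans ?_
  have := natDegree_polePoly_le S
  rw [natDegree_zeroPoly]; omega

theorem natDegree_critPoly_le (m : ℕ) (S : Multiset ℂ) :
    (critPoly m S).natDegree ≤ 2 * Multiset.card S := by
  induction S using Multiset.induction_on with
  | empty => simp
  | cons a S ih =>
    rw [critPoly_cons, Multiset.card_cons]
    refine (natDegree_add_le _ _).trans (max_le ?_ ?_)
    · refine natDegree_mul_le.trans ?_
      have : ((X - C a) * (1 - C (conj a) * X)).natDegree ≤ 2 := by compute_degree
      omega
    · refine natDegree_mul_le.trans ?_
      have : (X * C (1 - a * conj a)).natDegree ≤ 1 := by compute_degree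
      have := natDegree_symPoly_le S
      omega

theorem polePoly_eval_zero (S : Multiset ℂ) : (polePoly S).eval 0 = 1 := by
  induction S using Multiset.induction_on with
  | empty => simp
  | cons a S ih => simp [polePoly_cons, ih]

theorem polePoly_ne_zero (S : Multiset ℂ) : polePoly S ≠ 0 := by
  intro h
  have := polePoly_eval_zero S
  simp [h] at this

theorem symPoly_ne_zero (S : Multiset ℂ) : symPoly S ≠ 0 :=
  mul_ne_zero (zeroPoly_ne_zero S) (polePoly_ne_zero S)

theorem one_sub_conj_mul_ne_zero {a z : ℂ} (h : ‖a‖ * ‖z‖ < 1) : 1 - conj a * z ≠ 0 := by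
  intro h0
  have h1 : ‖conj a * z‖ = 1 := by rw [← sub_eq_zero.1 h0]; simp
  rw [norm_mul, RCLike.norm_conj] at h1
  exact h.ne h1

theorem polePoly_eval_ne_zero {S : Multiset ℂ} (hS : ∀ a ∈ S, ‖a‖ < 1) {z : ℂ} (hz : ‖z‖ ≤ 1) :
    (polePoly S).eval z ≠ 0 := by
  induction S using Multiset.induction_on with
  | empty => simp
  | cons a S ih =>
    rw [polePoly_cons, eval_mul]
    refine mul_ne_zero ?_ (ih fun b hb => hS b (Multiset.mem_cons_of_mem hb))
    simpa using one_sub_conj_mul_ne_zero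
      (mul_lt_one_of_nonneg_of_lt_one_left (norm_nonneg a) (hS a (Multiset.mem_cons_self a S)) hz)

theorem zeroPoly_eval_eq_zero_iff {S : Multiset ℂ} {z : ℂ} : (zeroPoly S).eval z = 0 ↔ z ∈ S := by
  rw [← IsRoot.def, ← mem_roots (zeroPoly_ne_zero S), roots_zeroPoly]

theorem sub_mul_one_sub_conj_mul {z : ℂ} (hz : ‖z‖ = 1) (a : ℂ) :
    (z - a) * (1 - conj a * z) = ((‖z - a‖ ^ 2 : ℝ) : ℂ) * z := by
  have h : z * conj z = 1 := by rw [Complex.mul_conj, Complex.normSq_eq_norm_sq, hz]; simp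
  have h2 : ((‖z - a‖ ^ 2 : ℝ) : ℂ) = (z - a) * conj (z - a) := by
    rw [Complex.mul_conj, Complex.normSq_eq_norm_sq]
  rw [h2, map_sub]
  linear_combination (a - z) * h

theorem norm_one_sub_conj_mul_sq (a z : ℂ) :
    ‖1 - conj a * z‖ ^ 2 - ‖z - a‖ ^ 2 = (1 - ‖z‖ ^ 2) * (1 - ‖a‖ ^ 2) := by
  simp only [← Complex.normSq_eq_norm_sq, Complex.normSq_apply]
  simp
  ring

theorem symPoly_eval_of_mem_circle (S : Multiset ℂ) {z : ℂ} (hz : ‖z‖ = 1) :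
    (symPoly S).eval z = ((‖(zeroPoly S).eval z‖ ^ 2 : ℝ) : ℂ) * z ^ Multiset.card S := by
  induction S using Multiset.induction_on with
  | empty => simp
  | cons a S ih =>
    rw [symPoly_cons, eval_mul, ih, zeroPoly_cons, eval_mul, Multiset.card_cons]
    have := sub_mul_one_sub_conj_mul hz a
    simp only [eval_mul, eval_sub, eval_X, eval_C, eval_one, norm_mul]
    rw [this]
    push_cast
    ring

/-- The quotient of `1 - |f|²` by `1 - |z|²`, cleared of denominators, for the Blaschke product
`f = z ^ m * zeroPoly S / polePoly S`. -/
theorem exists_defect_quotient {m : ℕ} (hm : 1 ≤ m) {S : Multiset ℂ} (hS : ∀ a ∈ S, ‖a‖ < 1) :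
    ∃ κ : ℂ → ℝ, Continuous κ ∧
      (∀ z, ‖(polePoly S).eval z‖ ^ 2 - ‖(X ^ m * zeroPoly S).eval z‖ ^ 2 =
        (1 - ‖z‖ ^ 2) * κ z) ∧
      (∀ z, ‖z‖ ≤ 1 → 0 < κ z) ∧
      ∀ z, ‖z‖ = 1 → (critPoly m S).eval z = κ z * z ^ Multiset.card S := by
  induction S using Multiset.induction_on with
  | empty =>
    refine ⟨fun z => ∑ i ∈ Finset.range m, (‖z‖ ^ 2) ^ i, by fun_prop, fun z => ?_, fun z _ => ?_,
      fun z hz => ?_⟩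
    · rw [mul_neg_geom_sum]
      simp [pow_right_comm]
    · obtain ⟨k, rfl⟩ : ∃ k, m = k + 1 := ⟨m - 1, by omega⟩
      beta_reduce
      rw [Finset.sum_range_succ']
      positivity
    · simp [hz]
  | cons a S ih =>
    have ha := hS a (Multiset.mem_cons_self a S)
    obtain ⟨κ, hc, hk, hp, hb⟩ := ih fun b hb => hS b (Multiset.mem_cons_of_mem hb)
    -- Expand |1 - conj a · z|²|Q|² - |z - a|²|P|² as |1 - conj a · z|²(|Q|² - |P|²) + (|1 - conj a
    -- · z|² - |z - a|²)|P|² and divide both parts by 1 - |z|².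
    refine ⟨fun z => (1 - ‖a‖ ^ 2) * ‖(X ^ m * zeroPoly S).eval z‖ ^ 2 +
      ‖1 - conj a * z‖ ^ 2 * κ z, ?_, fun z => ?_, fun z hz => ?_, fun z hz => ?_⟩
    · have := (X ^ m * zeroPoly S).continuous
      fun_prop
    · have h1 := norm_one_sub_conj_mul_sq a z
      have h2 := hk z
      simp only [polePoly_cons, zeroPoly_cons, eval_mul, eval_sub, eval_one, eval_C, eval_X,
        norm_mul, mul_pow, eval_pow] at h2 ⊢
      linear_combination (‖z ^ m‖ ^ 2 * ‖(zeroPoly S).eval z‖ ^ 2) * h1 +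
        ‖1 - conj a * z‖ ^ 2 * h2
    · have h1 := norm_pos_iff.2 (one_sub_conj_mul_ne_zero
        (mul_lt_one_of_nonneg_of_lt_one_left (norm_nonneg a) ha hz))
      have h2 := hp z hz
      have h3 : 0 ≤ 1 - ‖a‖ ^ 2 := by nlinarith [norm_nonneg a]
      positivity
    · have h1 := sub_mul_one_sub_conj_mul hz a
      have h2 := norm_one_sub_conj_mul_sq a z
      rw [hz] at h2
      have h4 : ‖z - a‖ ^ 2 = ‖1 - conj a * z‖ ^ 2 := by linarith
      rw [critPoly_cons, eval_add, eval_mul, eval_mul (q := symPoly S), hb z hz,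
        symPoly_eval_of_mem_circle S hz]
      simp only [eval_mul, eval_sub, eval_X, eval_C, eval_one, norm_mul, eval_pow, norm_pow, hz,
        one_pow, one_mul, Multiset.card_cons]
      rw [h1, h4, Complex.mul_conj, Complex.normSq_eq_norm_sq]
      push_cast
      ring

theorem critPoly_ne_zero_of_mem_disk {m : ℕ} (hm : 1 ≤ m) {S : Multiset ℂ}
    (hS : ∀ a ∈ S, ‖a‖ < 1) : critPoly m S ≠ 0 := by
  obtain ⟨κ, -, -, hp, hb⟩ := exists_defect_quotient hm hS
  intro h
  have h1 := hb 1 (by simp)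
  have h2 := hp 1 (by simp)
  rw [h] at h1
  simp only [eval_zero, one_pow, mul_one] at h1
  exact h2.ne (by exact_mod_cast h1)

theorem derivative_mul_sub_eq_critPoly {m : ℕ} (hm : 1 ≤ m) (S : Multiset ℂ) :
    derivative (X ^ m * zeroPoly S) * polePoly S - X ^ m * zeroPoly S * derivative (polePoly S) =
      X ^ (m - 1) * critPoly m S := by
  obtain ⟨k, rfl⟩ : ∃ k, m = k + 1 := ⟨m - 1, by omega⟩
  simp only [critPoly, derivative_mul, derivative_X_pow, Nat.add_sub_cancel]
  ring

theorem circle_infinite : {z : ℂ | ‖z‖ = 1}.Infinite := by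
  have h : (Metric.sphere (0 : ℂ) 1).Infinite := by
    have : (Metric.sphere (0 : ℂ) 1).Nontrivial :=
      ⟨1, by simp, -1, by simp, by norm_num⟩
    have hc : IsPreconnected (Metric.sphere (0 : ℂ) 1) :=
      (isConnected_sphere (by rw [Complex.rank_real_complex]; norm_num) 0 zero_le_one).isPreconnected
    exact hc.infinite_of_nontrivial this
  convert h using 1
  ext z; simp

theorem polynomial_eq_of_eval_circle {p q : ℂ[X]} (h : ∀ z, ‖z‖ = 1 → p.eval z = q.eval z) :
    p = q :=
  eq_of_infinite_eval_eq p q (circle_infinite.mono fun z hz => h z hz)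

end Polynomials

/-! ### Second-derivative test and the curvature equation. -/

section SecondDerivative

open Polynomial ComplexConjugate Topology Filter

/-- A positive second derivative would make x a local minimum as well, so φ would be locally
constant and the second derivative zero. -/
theorem IsLocalMax.second_deriv_nonpos {φ φ' : ℝ → ℝ} {c x : ℝ} (hmax : IsLocalMax φ x)
    (h1 : ∀ᶠ t in 𝓝 x, HasDerivAt φ (φ' t) t) (h2 : HasDerivAt φ' c x) : c ≤ 0 := by
  by_contra! hc
  have e1 : deriv φ =ᶠ[𝓝 x] φ' := h1.mono fun t ht => ht.deriv
  have e2 : deriv (deriv φ) x = c := by rw [e1.deriv_eq, h2.deriv]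
  have hmin : IsLocalMin φ x := isLocalMin_of_deriv_deriv_pos (by rw [e2]; exact hc)
    hmax.deriv_eq_zero h1.self_of_nhds.continuousAt
  have e3 : φ =ᶠ[𝓝 x] fun _ => φ x := by
    filter_upwards [hmax, hmin] with t ht1 ht2 using le_antisymm ht1 ht2
  have e4 : deriv φ =ᶠ[𝓝 x] fun _ => 0 := by simpa using e3.deriv
  have e5 : deriv (deriv φ) x = 0 := by rw [e4.deriv_eq]; simp
  linarith

theorem hasDerivAt_log_div {H H' : ℝ → ℝ} {c x : ℝ} (h1 : ∀ t, HasDerivAt H (H' t) t)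
    (h2 : HasDerivAt H' c x) (h0 : 0 < H x) :
    (∀ᶠ t in 𝓝 x, HasDerivAt (fun t => Real.log (H t)) (H' t / H t) t) ∧
      HasDerivAt (fun t => H' t / H t) ((c * H x - H' x ^ 2) / H x ^ 2) x := by
  constructor
  · filter_upwards [(h1 x).continuousAt.eventually (lt_mem_nhds h0)] with t ht
    exact (h1 t).log ht.ne'
  · have := h2.fun_div (h1 x) h0.ne'
    rwa [← pow_two] at this

theorem Polynomial.hasDerivAt_line (Q : ℂ[X]) (p θ : ℂ) (t : ℝ) :
    HasDerivAt (fun t : ℝ => Q.eval (p + t * θ)) (θ * (derivative Q).eval (p + t * θ)) t := by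
  have h1 : HasDerivAt (fun t : ℝ => p + (t : ℂ) * θ) θ t := by
    simpa using ((Complex.ofRealCLM.hasDerivAt (x := t)).mul_const θ).const_add p
  have := (Q.hasDerivAt (p + t * θ)).comp t h1
  rw [mul_comm]
  exact this

theorem Polynomial.hasDerivAt_norm_sq_line (Q : ℂ[X]) (p θ : ℂ) (t : ℝ) :
    HasDerivAt (fun t : ℝ => ‖Q.eval (p + t * θ)‖ ^ 2)
      (2 * (conj (Q.eval (p + t * θ)) * (θ * (derivative Q).eval (p + t * θ))).re) t := by
  have := (Q.hasDerivAt_line p θ t).norm_sq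
  simpa only [Complex.inner, mul_comm] using this

theorem Polynomial.hasDerivAt_deriv_norm_sq_line (Q : ℂ[X]) (p θ : ℂ) :
    HasDerivAt (fun t : ℝ =>
        2 * (conj (Q.eval (p + t * θ)) * (θ * (derivative Q).eval (p + t * θ))).re)
      (2 * (‖θ * (derivative Q).eval p‖ ^ 2 +
        (conj (Q.eval p) * (θ ^ 2 * (derivative (derivative Q)).eval p)).re)) 0 := by
  have h1 := Q.hasDerivAt_line p θ 0
  have h2 := ((derivative Q).hasDerivAt_line p θ 0).const_mul θ
  have h3 := (h1.inner ℝ h2).const_mul 2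
  simp only [Complex.inner, Complex.ofReal_zero, zero_mul, add_zero] at h3
  have e : ∀ z w : ℂ, (conj z * w).re = (w * conj z).re := fun z w => by rw [mul_comm]
  simp only [e]
  refine h3.congr_deriv ?_
  rw [Complex.mul_conj, Complex.normSq_eq_norm_sq, Complex.ofReal_re, add_comm]
  ring_nf

/-- The algebraic identity behind `Δ log (|Q|² - |P|²) = -4 |P' Q - P Q'|² / (|Q|² - |P|²)²`. -/
theorem laplacian_identity (s : ℝ) (q q' q'' r r' r'' : ℂ) :
    s * (2 * (‖1 * q'‖ ^ 2 + (conj q * (1 ^ 2 * q'')).re) -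
        2 * (‖1 * r'‖ ^ 2 + (conj r * (1 ^ 2 * r'')).re)) * (s * (‖q‖ ^ 2 - ‖r‖ ^ 2)) -
      (s * (2 * (conj q * (1 * q')).re - 2 * (conj r * (1 * r')).re)) ^ 2 +
    (s * (2 * (‖Complex.I * q'‖ ^ 2 + (conj q * (Complex.I ^ 2 * q'')).re) -
        2 * (‖Complex.I * r'‖ ^ 2 + (conj r * (Complex.I ^ 2 * r'')).re)) *
          (s * (‖q‖ ^ 2 - ‖r‖ ^ 2)) -
      (s * (2 * (conj q * (Complex.I * q')).re - 2 * (conj r * (Complex.I * r')).re)) ^ 2) =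
    -4 * ‖(s : ℂ) * (r' * q - r * q')‖ ^ 2 := by
  simp only [← Complex.normSq_eq_norm_sq, Complex.normSq_apply, Complex.I_sq]
  simp
  ring

/-- The local form of the comparison principle for the metrics `|f'| / (1 - |f|²)`, `f = P / Q`. -/
theorem not_isLocalMax_log_sub_log {P₁ Q₁ P₂ Q₂ : ℂ[X]} {s₁ s₂ ε : ℝ} (hε : 0 < ε) {p : ℂ}
    (h1 : 0 < s₁ * (‖Q₁.eval p‖ ^ 2 - ‖P₁.eval p‖ ^ 2))
    (h12 : s₁ * (‖Q₁.eval p‖ ^ 2 - ‖P₁.eval p‖ ^ 2) ≤ s₂ * (‖Q₂.eval p‖ ^ 2 - ‖P₂.eval p‖ ^ 2))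
    (hW : (s₁ : ℂ) * (derivative P₁ * Q₁ - P₁ * derivative Q₁).eval p =
      s₂ * (derivative P₂ * Q₂ - P₂ * derivative Q₂).eval p) :
    ¬ IsLocalMax (fun z : ℂ => Real.log (s₂ * (‖Q₂.eval z‖ ^ 2 - ‖P₂.eval z‖ ^ 2)) -
      Real.log (s₁ * (‖Q₁.eval z‖ ^ 2 - ‖P₁.eval z‖ ^ 2)) + ε * ‖(X : ℂ[X]).eval z‖ ^ 2) p := by
  intro hmax
  have h2 := h1.trans_le h12
  -- The second derivative at p along the real line in direction θ. Adding the cases θ = 1 and θ = I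
  -- gives the Laplacian without any two-variable calculus.
  have key : ∀ θ : ℂ,
      (s₂ * (2 * (‖θ * (derivative Q₂).eval p‖ ^ 2 +
            (conj (Q₂.eval p) * (θ ^ 2 * (derivative (derivative Q₂)).eval p)).re) -
          2 * (‖θ * (derivative P₂).eval p‖ ^ 2 +
            (conj (P₂.eval p) * (θ ^ 2 * (derivative (derivative P₂)).eval p)).re)) *
          (s₂ * (‖Q₂.eval p‖ ^ 2 - ‖P₂.eval p‖ ^ 2)) -
        (s₂ * (2 * (conj (Q₂.eval p) * (θ * (derivative Q₂).eval p)).re -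
          2 * (conj (P₂.eval p) * (θ * (derivative P₂).eval p)).re)) ^ 2) /
          (s₂ * (‖Q₂.eval p‖ ^ 2 - ‖P₂.eval p‖ ^ 2)) ^ 2 -
      (s₁ * (2 * (‖θ * (derivative Q₁).eval p‖ ^ 2 +
            (conj (Q₁.eval p) * (θ ^ 2 * (derivative (derivative Q₁)).eval p)).re) -
          2 * (‖θ * (derivative P₁).eval p‖ ^ 2 +
            (conj (P₁.eval p) * (θ ^ 2 * (derivative (derivative P₁)).eval p)).re)) *
          (s₁ * (‖Q₁.eval p‖ ^ 2 - ‖P₁.eval p‖ ^ 2)) -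
        (s₁ * (2 * (conj (Q₁.eval p) * (θ * (derivative Q₁).eval p)).re -
          2 * (conj (P₁.eval p) * (θ * (derivative P₁).eval p)).re)) ^ 2) /
          (s₁ * (‖Q₁.eval p‖ ^ 2 - ‖P₁.eval p‖ ^ 2)) ^ 2 +
      ε * (2 * ‖θ‖ ^ 2) ≤ 0 := fun θ => by
    have ht : Tendsto (fun t : ℝ => p + t * θ) (𝓝 0) (𝓝 p) := by
      have : ContinuousAt (fun t : ℝ => p + (t : ℂ) * θ) 0 := by fun_prop
      simpa [ContinuousAt] using this
    have hm : IsLocalMax ((fun z : ℂ => Real.log (s₂ * (‖Q₂.eval z‖ ^ 2 - ‖P₂.eval z‖ ^ 2)) -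
      Real.log (s₁ * (‖Q₁.eval z‖ ^ 2 - ‖P₁.eval z‖ ^ 2)) + ε * ‖(X : ℂ[X]).eval z‖ ^ 2) ∘
        fun t : ℝ => p + t * θ) 0 := by
      have hp : p + ((0 : ℝ) : ℂ) * θ = p := by simp
      exact IsMaxFilter.comp_tendsto (by rw [hp]; exact hmax) ht
    obtain ⟨a2, b2⟩ := hasDerivAt_log_div (x := 0)
      (fun t => ((Q₂.hasDerivAt_norm_sq_line p θ t).sub
        (P₂.hasDerivAt_norm_sq_line p θ t)).const_mul s₂)
      (((Q₂.hasDerivAt_deriv_norm_sq_line p θ).sub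
        (P₂.hasDerivAt_deriv_norm_sq_line p θ)).const_mul s₂) (by simpa using h2)
    obtain ⟨a1, b1⟩ := hasDerivAt_log_div (x := 0)
      (fun t => ((Q₁.hasDerivAt_norm_sq_line p θ t).sub
        (P₁.hasDerivAt_norm_sq_line p θ t)).const_mul s₁)
      (((Q₁.hasDerivAt_deriv_norm_sq_line p θ).sub
        (P₁.hasDerivAt_deriv_norm_sq_line p θ)).const_mul s₁) (by simpa using h1)
    have := hm.second_deriv_nonpos ?_ ((b2.sub b1).add
      (((X : ℂ[X]).hasDerivAt_deriv_norm_sq_line p θ).const_mul ε))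
    · simpa only [Pi.sub_apply, Complex.ofReal_zero, zero_mul, add_zero, derivative_X, eval_one,
        mul_one, derivative_one, eval_zero, mul_zero, Complex.zero_re] using this
    filter_upwards [a1, a2] with t t1 t2
    exact (t2.sub t1).add (((X : ℂ[X]).hasDerivAt_norm_sq_line p θ t).const_mul ε)
  have k1 := key 1
  have k2 := key Complex.I
  have e1 := laplacian_identity s₁ (Q₁.eval p) ((derivative Q₁).eval p)
    ((derivative (derivative Q₁)).eval p) (P₁.eval p) ((derivative P₁).eval p)
    ((derivative (derivative P₁)).eval p)
  have e2 := laplacian_identity s₂ (Q₂.eval p) ((derivative Q₂).eval p)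
    ((derivative (derivative Q₂)).eval p) (P₂.eval p) ((derivative P₂).eval p)
    ((derivative (derivative P₂)).eval p)
  simp only [eval_sub, eval_mul] at hW
  rw [← hW] at e2
  generalize s₁ * (‖Q₁.eval p‖ ^ 2 - ‖P₁.eval p‖ ^ 2) = u₁ at *
  generalize s₂ * (‖Q₂.eval p‖ ^ 2 - ‖P₂.eval p‖ ^ 2) = u₂ at *
  have k := add_le_add k1 k2
  have hn : ‖Complex.I‖ = 1 := Complex.norm_I
  rw [norm_one, hn] at k
  have h3 : ∀ a b a' b' : ℝ, a / u₂ ^ 2 - b / u₁ ^ 2 + ε * (2 * 1 ^ 2) +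
      (a' / u₂ ^ 2 - b' / u₁ ^ 2 + ε * (2 * 1 ^ 2)) = (a + a') / u₂ ^ 2 - (b + b') / u₁ ^ 2 + 4 * ε :=
    fun a b a' b' => by ring
  rw [h3, e1, e2] at k
  -- Both Laplacians have the same numerator by `hW`, so u₁ ≤ u₂ makes that of the difference of
  -- logarithms nonnegative. The ε-term adds 4ε > 0, against `k`.
  have h4 : (4 * ‖(s₁ : ℂ) * ((derivative P₁).eval p * Q₁.eval p -
      P₁.eval p * (derivative Q₁).eval p)‖ ^ 2) / u₂ ^ 2 ≤ (4 * ‖(s₁ : ℂ) *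
      ((derivative P₁).eval p * Q₁.eval p - P₁.eval p * (derivative Q₁).eval p)‖ ^ 2) / u₁ ^ 2 := by
    gcongr
  rw [neg_mul, neg_div, neg_div] at k
  linarith

end SecondDerivative

/-! ### Critical points determine the Blaschke product. -/

section Uniqueness

open Polynomial ComplexConjugate Topology Filter

/-- Maximum principle for the log-ratio of the two defects. Working with κ removes the common factor
1 - |z|², so the ratio is continuous up to the circle, where `hb` makes its logarithm zero. -/
theorem defect_le {P₁ Q₁ P₂ Q₂ : ℂ[X]} {s₁ s₂ : ℝ} (hs₁ : 0 < s₁) (hs₂ : 0 < s₂)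
    {κ₁ κ₂ : ℂ → ℝ} (hc₁ : Continuous κ₁) (hc₂ : Continuous κ₂)
    (hk₁ : ∀ z, ‖Q₁.eval z‖ ^ 2 - ‖P₁.eval z‖ ^ 2 = (1 - ‖z‖ ^ 2) * κ₁ z)
    (hk₂ : ∀ z, ‖Q₂.eval z‖ ^ 2 - ‖P₂.eval z‖ ^ 2 = (1 - ‖z‖ ^ 2) * κ₂ z)
    (hp₁ : ∀ z, ‖z‖ ≤ 1 → 0 < κ₁ z) (hp₂ : ∀ z, ‖z‖ ≤ 1 → 0 < κ₂ z)
    (hb : ∀ z, ‖z‖ = 1 → s₁ * κ₁ z = s₂ * κ₂ z)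
    (hW : C (s₁ : ℂ) * (derivative P₁ * Q₁ - P₁ * derivative Q₁) =
      C (s₂ : ℂ) * (derivative P₂ * Q₂ - P₂ * derivative Q₂)) {z : ℂ} (hz : ‖z‖ ≤ 1) :
    s₂ * κ₂ z ≤ s₁ * κ₁ z := by
  by_contra! hlt
  have p₁ : ∀ w, ‖w‖ ≤ 1 → 0 < s₁ * κ₁ w := fun w hw => mul_pos hs₁ (hp₁ w hw)
  have p₂ : ∀ w, ‖w‖ ≤ 1 → 0 < s₂ * κ₂ w := fun w hw => mul_pos hs₂ (hp₂ w hw)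
  set v : ℂ → ℝ := fun w => Real.log (s₂ * κ₂ w) - Real.log (s₁ * κ₁ w) with hv
  set M := v z with hM
  have hM0 : 0 < M := sub_pos.2 (Real.log_lt_log (p₁ z hz) hlt)
  -- The weight M/2 makes the perturbation strictly subharmonic but small: g = M/2 on the circle
  -- while g ≥ M at z, so the maximum is interior, and v is positive there.
  set g : ℂ → ℝ := fun w => v w + M / 2 * ‖w‖ ^ 2 with hg
  have hgc : ContinuousOn g (Metric.closedBall 0 1) := by
    refine ContinuousOn.add (ContinuousOn.sub ?_ ?_) (by fun_prop)
    · exact ContinuousOn.log (by fun_prop) fun w hw => (p₂ w (by simpa using hw)).ne'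
    · exact ContinuousOn.log (by fun_prop) fun w hw => (p₁ w (by simpa using hw)).ne'
  obtain ⟨p, hp, hmax⟩ := (isCompact_closedBall (0 : ℂ) 1).exists_isMaxOn ⟨0, by simp⟩ hgc
  have hp1 : ‖p‖ ≤ 1 := by simpa using hp
  have hgp : M ≤ g p := by
    have h1 : g z ≤ g p := hmax (by simpa using hz)
    have h2 : 0 ≤ M / 2 * ‖z‖ ^ 2 := by positivity
    have h3 : g z = M + M / 2 * ‖z‖ ^ 2 := rfl
    linarith
  have hlt1 : ‖p‖ < 1 := by
    refine hp1.lt_of_ne fun h => ?_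
    have : g p = M / 2 := by simp [hg, hv, hb p h, h]
    linarith
  have hvp : 0 < v p := by
    have : g p = v p + M / 2 * ‖p‖ ^ 2 := rfl
    have : ‖p‖ ^ 2 < 1 := by nlinarith [norm_nonneg p]
    nlinarith
  have hloc : IsLocalMax g p :=
    hmax.isLocalMax (Metric.closedBall_mem_nhds_of_mem (by simpa using hlt1))
  have hsq : ∀ w : ℂ, ‖w‖ < 1 → 0 < 1 - ‖w‖ ^ 2 := fun w hw => by nlinarith [norm_nonneg w]
  refine not_isLocalMax_log_sub_log (P₁ := P₁) (Q₁ := Q₁) (P₂ := P₂) (Q₂ := Q₂)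
    (s₁ := s₁) (s₂ := s₂) (half_pos hM0) (p := p) ?_ ?_ ?_ ?_
  · rw [hk₁]
    exact mul_pos hs₁ (mul_pos (hsq p hlt1) (hp₁ p hp1))
  · have : s₁ * κ₁ p < s₂ * κ₂ p :=
      (Real.log_lt_log_iff (p₁ p hp1) (p₂ p hp1)).1 (sub_pos.1 hvp)
    rw [hk₁, hk₂]
    nlinarith [hsq p hlt1]
  · simpa using congrArg (eval p) hW
  · refine hloc.congr ?_
    filter_upwards [Metric.isOpen_ball.mem_nhds (show p ∈ Metric.ball (0 : ℂ) 1 by simpa using hlt1)]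
      with w hw
    have hw1 : ‖w‖ < 1 := by simpa using hw
    have e : ∀ s k : ℝ, s * ((1 - ‖w‖ ^ 2) * k) = (1 - ‖w‖ ^ 2) * (s * k) := fun s k => by ring
    rw [hk₁, hk₂, e, e, Real.log_mul (hsq w hw1).ne' (p₂ w hw1.le).ne',
      Real.log_mul (hsq w hw1).ne' (p₁ w hw1.le).ne', eval_X]
    simp only [hg, hv]
    ring

theorem eval_eq_zero_of_real {R : ℂ[X]} (h : ∀ x : ℝ, |x| < 1 / 2 → R.eval (x : ℂ) = 0) (x : ℂ) :
    R.eval x = 0 := by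
  have : R = 0 := by
    refine eq_zero_of_infinite_isRoot R ?_
    have h1 : ((fun x : ℝ => (x : ℂ)) '' Set.Ioo (-(1 / 2)) (1 / 2)).Infinite :=
      (Set.Ioo_infinite (by norm_num)).image Complex.ofReal_injective.injOn
    refine h1.mono ?_
    rintro _ ⟨x, hx, rfl⟩
    exact h x (abs_lt.2 hx)
  rw [this, eval_zero]

theorem eval_map_conj (Q : ℂ[X]) (z : ℂ) :
    (Q.map (starRingEnd ℂ)).eval (conj z) = conj (Q.eval z) := by
  rw [eval_map, eval₂_at_apply]

/-- Polarization of a Hermitian identity, evaluated at `w = 0`. -/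
theorem eq_of_norm_sq_sub_norm_sq_eq {P₁ Q₁ P₂ Q₂ : ℂ[X]} {s₁ s₂ : ℝ} (hs₁ : 0 < s₁)
    (h : ∀ z, ‖z‖ ≤ 1 → s₁ * (‖Q₁.eval z‖ ^ 2 - ‖P₁.eval z‖ ^ 2) =
      s₂ * (‖Q₂.eval z‖ ^ 2 - ‖P₂.eval z‖ ^ 2))
    (hP₁ : P₁.eval 0 = 0) (hP₂ : P₂.eval 0 = 0) (hQ₁ : Q₁.eval 0 = 1) (hQ₂ : Q₂.eval 0 = 1) :
    Q₁ = Q₂ := by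
  have hs : s₁ = s₂ := by simpa [hP₁, hP₂, hQ₁, hQ₂] using h 0 (by simp)
  subst hs
  set c := starRingEnd ℂ
  -- Write z = x + iy and conj z = x - iy. The identity is polynomial in x and y, so it extends to
  -- complex x and then complex y, making z and conj z independent variables. The bound 1/2 keeps z
  -- in the unit disk.
  have h0 : ∀ x y : ℝ, |x| < 1 / 2 → |y| < 1 / 2 →
      Q₁.eval (x + y * Complex.I) * (Q₁.map c).eval (x - y * Complex.I) -
        P₁.eval (x + y * Complex.I) * (P₁.map c).eval (x - y * Complex.I) -
      (Q₂.eval (x + y * Complex.I) * (Q₂.map c).eval (x - y * Complex.I) -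
        P₂.eval (x + y * Complex.I) * (P₂.map c).eval (x - y * Complex.I)) = 0 := by
    intro x y hx hy
    have hc : (x - y * Complex.I : ℂ) = conj (x + y * Complex.I : ℂ) := by simp; ring
    have hz : ‖(x + y * Complex.I : ℂ)‖ ≤ 1 := by
      refine (norm_add_le _ _).trans ?_
      simp only [norm_mul, Complex.norm_real, Complex.norm_I, mul_one, Real.norm_eq_abs]
      linarith
    have := mul_left_cancel₀ hs₁.ne' (h _ hz)
    rw [hc]
    simp only [c, eval_map_conj, Complex.mul_conj, Complex.normSq_eq_norm_sq]
    rw [sub_eq_zero]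
    exact_mod_cast this
  have h1 : ∀ (x : ℂ) (y : ℝ), |y| < 1 / 2 →
      Q₁.eval (x + y * Complex.I) * (Q₁.map c).eval (x - y * Complex.I) -
        P₁.eval (x + y * Complex.I) * (P₁.map c).eval (x - y * Complex.I) -
      (Q₂.eval (x + y * Complex.I) * (Q₂.map c).eval (x - y * Complex.I) -
        P₂.eval (x + y * Complex.I) * (P₂.map c).eval (x - y * Complex.I)) = 0 := by
    intro x y hy
    have := eval_eq_zero_of_real (R :=
      Q₁.comp (X + C (y * Complex.I)) * (Q₁.map c).comp (X - C (y * Complex.I)) -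
        P₁.comp (X + C (y * Complex.I)) * (P₁.map c).comp (X - C (y * Complex.I)) -
      (Q₂.comp (X + C (y * Complex.I)) * (Q₂.map c).comp (X - C (y * Complex.I)) -
        P₂.comp (X + C (y * Complex.I)) * (P₂.map c).comp (X - C (y * Complex.I))))
      (fun x hx => by
        simp only [eval_sub, eval_mul, eval_comp, eval_add, eval_X, eval_C]
        exact h0 x y hx hy) x
    simpa only [eval_sub, eval_mul, eval_comp, eval_add, eval_X, eval_C] using this
  have h2 : ∀ (x y : ℂ),
      Q₁.eval (x + y * Complex.I) * (Q₁.map c).eval (x - y * Complex.I) -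
        P₁.eval (x + y * Complex.I) * (P₁.map c).eval (x - y * Complex.I) -
      (Q₂.eval (x + y * Complex.I) * (Q₂.map c).eval (x - y * Complex.I) -
        P₂.eval (x + y * Complex.I) * (P₂.map c).eval (x - y * Complex.I)) = 0 := by
    intro x y
    have := eval_eq_zero_of_real (R :=
      Q₁.comp (C x + X * C Complex.I) * (Q₁.map c).comp (C x - X * C Complex.I) -
        P₁.comp (C x + X * C Complex.I) * (P₁.map c).comp (C x - X * C Complex.I) -
      (Q₂.comp (C x + X * C Complex.I) * (Q₂.map c).comp (C x - X * C Complex.I) -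
        P₂.comp (C x + X * C Complex.I) * (P₂.map c).comp (C x - X * C Complex.I)))
      (fun y hy => by
        simp only [eval_sub, eval_mul, eval_comp, eval_add, eval_X, eval_C]
        exact h1 x y hy) y
    simpa only [eval_sub, eval_mul, eval_comp, eval_add, eval_X, eval_C] using this
  refine Polynomial.funext fun z => ?_
  -- These values give x + iy = z and x - iy = 0.
  have h3 := h2 (z / 2) (-Complex.I * (z / 2))
  have e1 : z / 2 + -Complex.I * (z / 2) * Complex.I = z := by
    linear_combination (-(z / 2)) * Complex.I_mul_I
  have e2 : z / 2 - -Complex.I * (z / 2) * Complex.I = 0 := by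
    linear_combination (z / 2) * Complex.I_mul_I
  have e3 : ∀ R : ℂ[X], (R.map c).eval 0 = conj (R.eval 0) := fun R => by
    have := eval_map_conj R 0
    rwa [map_zero] at this
  rw [e1, e2, e3, e3, e3, e3, hP₁, hP₂, hQ₁, hQ₂] at h3
  simpa [sub_eq_zero] using h3

theorem polePoly_eval_of_mem_circle (S : Multiset ℂ) {z : ℂ} (hz : ‖z‖ = 1) :
    (polePoly S).eval z = z ^ Multiset.card S * conj ((zeroPoly S).eval z) := by
  have h : z * conj z = 1 := by rw [Complex.mul_conj, Complex.normSq_eq_norm_sq, hz]; simp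
  induction S using Multiset.induction_on with
  | empty => simp
  | cons a S ih =>
    rw [polePoly_cons, zeroPoly_cons, eval_mul, eval_mul, ih, Multiset.card_cons]
    simp only [eval_sub, eval_one, eval_mul, eval_C, eval_X, map_mul, map_sub]
    linear_combination (-(z ^ Multiset.card S * conj ((zeroPoly S).eval z))) * h

/-- Zeros at the origin are invisible in `polePoly`; the equal cardinalities account for them. On
the circle `polePoly` is z^d times the conjugate of `zeroPoly`. -/
theorem eq_of_polePoly_eq {S T : Multiset ℂ} (hc : Multiset.card S = Multiset.card T)
    (h : polePoly S = polePoly T) : S = T := by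
  have : zeroPoly S = zeroPoly T := by
    refine polynomial_eq_of_eval_circle fun z hz => ?_
    have h0 : z ≠ 0 := by rintro rfl; simp at hz
    have h1 := congrArg (eval z) h
    rw [polePoly_eval_of_mem_circle S hz, polePoly_eval_of_mem_circle T hz, hc] at h1
    exact (starRingEnd ℂ).injective (mul_left_cancel₀ (pow_ne_zero _ h0) h1)
  rw [← roots_zeroPoly S, this, roots_zeroPoly]

/-- A finite Blaschke product with a prescribed zero of order at least `m ≥ 1` at the origin is
determined by its critical points. -/
theorem eq_of_critPoly_eq {m : ℕ} (hm : 1 ≤ m) {S T : Multiset ℂ} (hS : ∀ a ∈ S, ‖a‖ < 1)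
    (hT : ∀ a ∈ T, ‖a‖ < 1) (hc : Multiset.card S = Multiset.card T) {s t : ℝ} (hs : 0 < s)
    (ht : 0 < t) (h : C (s : ℂ) * critPoly m S = C (t : ℂ) * critPoly m T) : S = T := by
  obtain ⟨κ₁, hc₁, hk₁, hp₁, hb₁⟩ := exists_defect_quotient hm hS
  obtain ⟨κ₂, hc₂, hk₂, hp₂, hb₂⟩ := exists_defect_quotient hm hT
  have hb : ∀ z, ‖z‖ = 1 → s * κ₁ z = t * κ₂ z := fun z hz => by
    have h0 : z ≠ 0 := by rintro rfl; simp at hz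
    have h1 := congrArg (eval z) h
    rw [eval_mul, eval_mul, eval_C, eval_C, hb₁ z hz, hb₂ z hz, hc, ← mul_assoc, ← mul_assoc] at h1
    exact_mod_cast mul_right_cancel₀ (pow_ne_zero _ h0) h1
  have hW := congrArg (fun p => X ^ (m - 1) * p) h
  simp only [mul_left_comm (X ^ (m - 1) : ℂ[X]), ← derivative_mul_sub_eq_critPoly hm] at hW
  have hz0 : ∀ R : ℂ[X], (X ^ m * R).eval 0 = 0 := fun R => by
    simp [show m ≠ 0 by omega]
  refine eq_of_polePoly_eq hc (eq_of_norm_sq_sub_norm_sq_eq (s₁ := s) (s₂ := t) hs (fun z hz => ?_)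
    (hz0 (zeroPoly S)) (hz0 (zeroPoly T)) (polePoly_eval_zero S) (polePoly_eval_zero T))
  rw [hk₁, hk₂, mul_left_comm, mul_left_comm t,
    le_antisymm (defect_le ht hs hc₂ hc₁ hk₂ hk₁ hp₂ hp₁ (fun w hw => (hb w hw).symm) hW.symm hz)
      (defect_le hs ht hc₁ hc₂ hk₁ hk₂ hp₁ hp₂ hb hW hz)]

end Uniqueness

/-! ### Self-inversive polynomials and Fejér–Riesz factorization. -/

section FejerRiesz

open Polynomial ComplexConjugate Topology Filter

theorem rootMultiplicity_zeroPoly [DecidableEq ℂ] (S : Multiset ℂ) (q : ℂ) :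
    (zeroPoly S).rootMultiplicity q = S.count q := by
  classical
  rw [← count_roots, roots_zeroPoly]

theorem rootMultiplicity_polePoly_of_mem_disk {S : Multiset ℂ} (hS : ∀ a ∈ S, ‖a‖ ≤ 1) {q : ℂ}
    (hq : ‖q‖ < 1) : (polePoly S).rootMultiplicity q = 0 := by
  refine rootMultiplicity_eq_zero fun h => ?_
  rw [IsRoot.def] at h
  induction S using Multiset.induction_on with
  | empty => simp at h
  | cons a S ih =>
    rw [polePoly_cons, eval_mul] at h
    rcases mul_eq_zero.1 h with h | h
    · exact one_sub_conj_mul_ne_zero (mul_lt_one_of_nonneg_of_lt_one_right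
        (hS a (Multiset.mem_cons_self a S)) (norm_nonneg q) hq) (by simpa using h)
    · exact ih (fun b hb => hS b (Multiset.mem_cons_of_mem hb)) h

theorem one_sub_conj_mul_X_ne_zero (a : ℂ) : (1 - C (conj a) * X : ℂ[X]) ≠ 0 := by
  intro h
  simpa using congrArg (eval 0) h

theorem rootMultiplicity_polePoly_of_mem_circle [DecidableEq ℂ] {S : Multiset ℂ}
    {q : ℂ} (hq : ‖q‖ = 1) : (polePoly S).rootMultiplicity q = S.count q := by
  have h : q * conj q = 1 := by rw [Complex.mul_conj, Complex.normSq_eq_norm_sq, hq]; simp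
  induction S using Multiset.induction_on with
  | empty => simp [rootMultiplicity_eq_zero]
  | cons a S ih =>
    rw [polePoly_cons, rootMultiplicity_mul (mul_ne_zero (one_sub_conj_mul_X_ne_zero a)
      (polePoly_ne_zero S)), ih, Multiset.count_cons, add_comm]
    congr 1
    split_ifs with hqa
    · subst hqa
      have e : (1 - C (conj q) * X : ℂ[X]) = C (-conj q) * (X - C q) := by
        have : C q * C (conj q) = (1 : ℂ[X]) := by rw [← C_mul, h, C_1]
        rw [C_neg]
        linear_combination -this
      have h0 : conj q ≠ 0 := right_ne_zero_of_mul_eq_one h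
      rw [e, rootMultiplicity_mul (mul_ne_zero (by simpa using h0) (X_sub_C_ne_zero q)),
        rootMultiplicity_C, rootMultiplicity_X_sub_C_self]
    · refine rootMultiplicity_eq_zero fun hr => hqa ?_
      have hr' : 1 - conj a * q = 0 := by simpa using hr
      have h2 : conj a = conj q := by linear_combination conj a * (-h) - conj q * hr'
      exact ((starRingEnd ℂ).injective h2).symm

/-- Count root multiplicities in the closed disk: an interior point is a root of the `zeroPoly`
factor only, a circle point of both factors equally, hence with twice its multiplicity. -/
theorem eq_of_symPoly_eq {S T : Multiset ℂ} (hS : ∀ a ∈ S, ‖a‖ ≤ 1) (hT : ∀ a ∈ T, ‖a‖ ≤ 1)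
    {c : ℂ} (hc : c ≠ 0) (h : symPoly S = C c * symPoly T) : S = T := by
  classical
  ext q
  rcases lt_or_ge 1 ‖q‖ with hq | hq
  · rw [Multiset.count_eq_zero.2 fun hm => (hS q hm).not_gt hq,
      Multiset.count_eq_zero.2 fun hm => (hT q hm).not_gt hq]
  have h1 := congrArg (rootMultiplicity q) h
  rw [rootMultiplicity_mul (mul_ne_zero (C_ne_zero.2 hc) (symPoly_ne_zero T)), rootMultiplicity_C,
    symPoly, symPoly, rootMultiplicity_mul (symPoly_ne_zero S),
    rootMultiplicity_mul (symPoly_ne_zero T), rootMultiplicity_zeroPoly,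
    rootMultiplicity_zeroPoly] at h1
  rcases hq.lt_or_eq with hq | hq
  · rw [rootMultiplicity_polePoly_of_mem_disk hS hq,
      rootMultiplicity_polePoly_of_mem_disk hT hq] at h1
    omega
  · rw [rootMultiplicity_polePoly_of_mem_circle hq,
      rootMultiplicity_polePoly_of_mem_circle hq] at h1
    omega

theorem eval_reflect_map_conj {N : ℕ} {H : ℂ[X]} (hH : H.natDegree ≤ N) {z : ℂ} (hz : z ≠ 0) :
    (reflect N (H.map (starRingEnd ℂ))).eval z = z ^ N * conj (H.eval (conj z)⁻¹) := by
  let _ : Invertible z⁻¹ := invertibleOfNonzero (inv_ne_zero hz)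
  have h1 := eval₂_reflect_mul_pow (RingHom.id ℂ) z⁻¹ N (H.map (starRingEnd ℂ))
    (natDegree_map_le.trans hH)
  have h2 : ⅟(z⁻¹) = z := by rw [invOf_eq_inv, inv_inv]
  rw [h2, eval₂_id, eval₂_id] at h1
  have h3 := eval_map_conj H (conj z)⁻¹
  rw [map_inv₀, Complex.conj_conj] at h3
  rw [← h3, ← h1, inv_pow]
  field_simp

/-- Reality of H/z^d on the circle says H(z) = z^(2d) conj(H(1/conj z)) there, and an identity of
polynomials on an infinite set is global. -/
theorem self_reflect_of_real_on_circle {d : ℕ} {H : ℂ[X]} (hH : H.natDegree ≤ 2 * d)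
    (hr : ∀ z, ‖z‖ = 1 → ∃ r : ℝ, H.eval z = r * z ^ d) :
    H = reflect (2 * d) (H.map (starRingEnd ℂ)) := by
  refine polynomial_eq_of_eval_circle fun z hz => ?_
  have h : z * conj z = 1 := by rw [Complex.mul_conj, Complex.normSq_eq_norm_sq, hz]; simp
  have h0 : z ≠ 0 := left_ne_zero_of_mul_eq_one h
  have hd : z ^ d * conj z ^ d = 1 := by rw [← mul_pow, h, one_pow]
  obtain ⟨r, hr⟩ := hr z hz
  rw [eval_reflect_map_conj hH h0, inv_eq_of_mul_eq_one_left h, hr, map_mul, map_pow,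
    Complex.conj_ofReal, two_mul, pow_add]
  linear_combination (-(r : ℂ) * z ^ d) * hd

/-- Roots avoid the circle and are symmetric under c ↦ 1/conj c, so any root yields one inside. A
nonzero constant is excluded since reflection would carry its constant term to degree 2(d+1). -/
theorem exists_root_mem_disk {d : ℕ} {H : ℂ[X]} (hH : H.natDegree ≤ 2 * (d + 1))
    (hr : ∀ z, ‖z‖ = 1 → ∃ r : ℝ, r ≠ 0 ∧ H.eval z = r * z ^ (d + 1)) :
    ∃ c, ‖c‖ < 1 ∧ H.eval c = 0 := by
  have hrefl := self_reflect_of_real_on_circle hH fun z hz => (hr z hz).imp fun r h => h.2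
  obtain ⟨r, hr0, hr1⟩ := hr 1 (by simp)
  have hne : H ≠ 0 := by
    rintro rfl
    simp only [eval_zero, one_pow, mul_one] at hr1
    exact hr0 (by exact_mod_cast hr1.symm)
  have hdeg : 0 < H.degree := by
    by_contra! hdeg
    have h1 := eq_C_of_degree_le_zero hdeg
    have h2 : H.coeff 0 = 0 := by
      have h3 := congrArg (fun p => coeff p 0) hrefl
      simp only [coeff_reflect, revAt_le (Nat.zero_le _), coeff_map, Nat.sub_zero] at h3
      rw [h3, coeff_eq_zero_of_natDegree_lt, map_zero]
      rw [h1, natDegree_C]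
      omega
    rw [h2, C_0] at h1
    exact hne h1
  obtain ⟨c, hc⟩ := Complex.exists_root hdeg
  rw [IsRoot.def] at hc
  rcases lt_trichotomy ‖c‖ 1 with h | h | h
  · exact ⟨c, h, hc⟩
  · obtain ⟨r, hr0, hr1⟩ := hr c h
    have h0 : c ≠ 0 := by rintro rfl; simp at h
    rw [hc] at hr1
    exact absurd hr1.symm (mul_ne_zero (by exact_mod_cast hr0) (pow_ne_zero _ h0))
  · have h0 : c ≠ 0 := by rintro rfl; norm_num at h
    refine ⟨(conj c)⁻¹, ?_, ?_⟩
    · rw [norm_inv, RCLike.norm_conj]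
      exact inv_lt_one_of_one_lt₀ h
    · rw [hrefl, eval_reflect_map_conj hH (inv_ne_zero (by simpa using h0)), map_inv₀, inv_inv,
        Complex.conj_conj, hc, map_zero, mul_zero]

/-- The root c is removed together with its mirror image 1/conj c. For c = 0 the mirror root is at
infinity and shows up as a drop in degree. -/
theorem factor_dvd_of_root {d : ℕ} {H : ℂ[X]} (hH : H.natDegree ≤ 2 * (d + 1))
    (hrefl : H = reflect (2 * (d + 1)) (H.map (starRingEnd ℂ))) {c : ℂ} (hc1 : ‖c‖ < 1)
    (hc : H.eval c = 0) :
    ∃ K : ℂ[X], H = (X - C c) * (1 - C (conj c) * X) * K ∧ K.natDegree ≤ 2 * d := by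
  rcases eq_or_ne H 0 with rfl | hne
  · exact ⟨0, by simp⟩
  obtain ⟨K, hK⟩ := dvd_iff_isRoot.2 hc
  have hK0 : K ≠ 0 := by rintro rfl; exact hne (by rw [hK, mul_zero])
  have hKdeg : H.natDegree = 1 + K.natDegree := by
    rw [hK, natDegree_mul (X_sub_C_ne_zero c) hK0, natDegree_X_sub_C]
  rcases eq_or_ne c 0 with rfl | hc0
  · refine ⟨K, by simpa using hK, ?_⟩
    have h1 : H.coeff (2 * (d + 1)) = 0 := by
      have h3 := congrArg (fun p => coeff p (2 * (d + 1))) hrefl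
      simp only [coeff_reflect, revAt_le le_rfl, coeff_map, Nat.sub_self] at h3
      rw [h3, coeff_zero_eq_eval_zero, hc, map_zero]
    have h2 : H.natDegree ≠ 2 * (d + 1) := fun h => by
      rw [← h, coeff_natDegree, leadingCoeff_eq_zero] at h1
      exact hne h1
    omega
  · have hcc : conj c ≠ 0 := by simpa using hc0
    have hw : H.eval (conj c)⁻¹ = 0 := by
      rw [hrefl, eval_reflect_map_conj hH (inv_ne_zero hcc), map_inv₀, inv_inv,
        Complex.conj_conj, hc, map_zero, mul_zero]
    have hwc : (conj c)⁻¹ - c ≠ 0 := by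
      intro h
      have h1 := congrArg norm (sub_eq_zero.1 h)
      rw [norm_inv, RCLike.norm_conj] at h1
      have h2 := one_lt_inv₀ (norm_pos_iff.2 hc0) |>.2 hc1
      linarith
    rw [hK, eval_mul, eval_sub, eval_X, eval_C] at hw
    obtain ⟨M, hM⟩ := dvd_iff_isRoot.2 ((mul_eq_zero.1 hw).resolve_left hwc)
    have hM0 : M ≠ 0 := by rintro rfl; exact hK0 (by rw [hM, mul_zero])
    refine ⟨C (-(conj c)⁻¹) * M, ?_, ?_⟩
    · have e : (C (conj c) * C (conj c)⁻¹ : ℂ[X]) = 1 := by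
        rw [← C_mul, mul_inv_cancel₀ hcc, C_1]
      rw [hK, hM, C_neg]
      linear_combination (-(X - C c) * X * M) * e
    · refine (natDegree_C_mul_le _ _).trans ?_
      have : K.natDegree = 1 + M.natDegree := by
        rw [hM, natDegree_mul (X_sub_C_ne_zero _) hM0, natDegree_X_sub_C]
      omega

/-- Fejér–Riesz: a self-inversive polynomial of degree at most `2 * d` without zeros on the unit
circle is a multiple of `symPoly S` for some `S` in the open disk. -/
theorem exists_eq_C_mul_symPoly (d : ℕ) (H : ℂ[X]) (hH : H.natDegree ≤ 2 * d)
    (hr : ∀ z, ‖z‖ = 1 → ∃ r : ℝ, r ≠ 0 ∧ H.eval z = r * z ^ d) :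
    ∃ (S : Multiset ℂ) (c : ℂ), Multiset.card S = d ∧ (∀ a ∈ S, ‖a‖ < 1) ∧ c ≠ 0 ∧
      H = C c * symPoly S := by
  induction d generalizing H with
  | zero =>
    obtain ⟨r, hr0, hr1⟩ := hr 1 (by simp)
    have h1 := eq_C_of_natDegree_le_zero hH
    refine ⟨0, H.coeff 0, rfl, by simp, fun h => ?_, by simpa using h1⟩
    rw [h1, h, eval_C, pow_zero, mul_one] at hr1
    exact hr0 (by exact_mod_cast hr1.symm)
  | succ d ih =>
    obtain ⟨c, hc1, hc⟩ := exists_root_mem_disk hH hr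
    obtain ⟨K, hK, hKd⟩ := factor_dvd_of_root hH
      (self_reflect_of_real_on_circle hH fun z hz => (hr z hz).imp fun r h => h.2) hc1 hc
    obtain ⟨S, b, hS, hS1, hb, hKS⟩ := ih K hKd fun z hz => by
      obtain ⟨r, hr0, hr1⟩ := hr z hz
      have h0 : z ≠ 0 := by rintro rfl; simp at hz
      have hzc : ‖z - c‖ ≠ 0 := by
        rw [norm_ne_zero_iff, sub_ne_zero]
        rintro rfl
        exact hc1.ne hz
      refine ⟨r / ‖z - c‖ ^ 2, div_ne_zero hr0 (pow_ne_zero _ hzc), ?_⟩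
      have e := sub_mul_one_sub_conj_mul hz c
      rw [hK] at hr1
      simp only [eval_mul, eval_sub, eval_X, eval_C, eval_one] at hr1
      rw [e, pow_succ] at hr1
      have hzc' : (‖z - c‖ : ℂ) ≠ 0 := by exact_mod_cast hzc
      push_cast at hr1 ⊢
      field_simp
      exact mul_right_cancel₀ h0 (by linear_combination hr1)
    refine ⟨c ::ₘ S, b, by simp [hS], fun a ha => ?_, hb, ?_⟩
    · rcases Multiset.mem_cons.1 ha with rfl | ha
      exacts [hc1, hS1 a ha]
    · rw [hK, hKS, symPoly_cons]; ring

theorem exists_critPoly_eq {m : ℕ} (hm : 1 ≤ m) {S : Multiset ℂ} (hS : ∀ a ∈ S, ‖a‖ < 1) :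
    ∃ (T : Multiset ℂ) (c : ℂ), Multiset.card T = Multiset.card S ∧ (∀ a ∈ T, ‖a‖ < 1) ∧ c ≠ 0 ∧
      critPoly m S = C c * symPoly T := by
  obtain ⟨κ, -, -, hp, hb⟩ := exists_defect_quotient hm hS
  exact exists_eq_C_mul_symPoly _ _ (natDegree_critPoly_le m S) fun z hz =>
    ⟨κ z, (hp z hz.le).ne', hb z hz⟩

end FejerRiesz

/-! ### The critical polynomial as a quadratic map; openness of its image. -/

section InverseFunction

open Polynomial ComplexConjugate Topology Filter

/-- A quadratic map which is injective on an open set is a local homeomorphism there. -/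
theorem map_nhds_eq_of_quadratic_injOn {E V : Type*} [NormedAddCommGroup E] [NormedSpace ℝ E]
    [FiniteDimensional ℝ E] [NormedAddCommGroup V] [NormedSpace ℝ V] [FiniteDimensional ℝ V]
    (hfin : Module.finrank ℝ E = Module.finrank ℝ V) (B : E →ₗ[ℝ] E →ₗ[ℝ] V) {A : Set E}
    (hA : IsOpen A) (hinj : Set.InjOn (fun x => B x x) A) {x : E} (hx : x ∈ A) :
    map (fun x => B x x) (𝓝 x) = 𝓝 (B x x) := by
  have : CompleteSpace E := FiniteDimensional.complete ℝ E
  set L : E →ₗ[ℝ] V := B x + B.flip x with hL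
  have hLi : Function.Injective L := by
    rw [← LinearMap.ker_eq_bot, LinearMap.ker_eq_bot']
    intro h hh
    by_contra hne
    -- If h is in the kernel of the derivative B(x,·) + B(·,x), the quadratic map takes equal values
    -- at x + th and x - th, against injectivity for small t > 0.
    have c₁ : ∀ᶠ t : ℝ in 𝓝 0, x + t • h ∈ A :=
      (show ContinuousAt (fun t : ℝ => x + t • h) 0 by fun_prop).eventually
        (hA.mem_nhds (by simpa using hx))
    have c₂ : ∀ᶠ t : ℝ in 𝓝 0, x - t • h ∈ A :=
      (show ContinuousAt (fun t : ℝ => x - t • h) 0 by fun_prop).eventually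
        (hA.mem_nhds (by simpa using hx))
    have c₃ : ∀ᶠ t : ℝ in 𝓝[>] 0, x + t • h ∈ A ∧ x - t • h ∈ A :=
      nhdsWithin_le_nhds (c₁.and c₂)
    obtain ⟨t, ⟨h₁, h₂⟩, ht⟩ := (c₃.and self_mem_nhdsWithin).exists
    have ht0 : (0 : ℝ) < t := ht
    have hB : B x h + B h x = 0 := by simpa [hL] using hh
    have e : x + t • h = x - t • h := hinj h₁ h₂ (by
      simp only [map_add, map_sub, map_smul, LinearMap.add_apply, LinearMap.sub_apply,
        LinearMap.smul_apply]
      have : B h x = -B x h := (neg_eq_of_add_eq_zero_right hB).symm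
      rw [this]
      module)
    have e2 : (2 * t) • h = 0 := by
      have : (2 * t) • h = (x + t • h) - (x - t • h) := by module
      rw [this, e, sub_self]
    exact hne ((smul_eq_zero.1 e2).resolve_left (by positivity))
  let Le : E ≃L[ℝ] V := (LinearEquiv.ofInjectiveOfFinrankEq L hLi hfin).toContinuousLinearEquiv
  have hd := B.toContinuousBilinearMap.hasStrictFDerivAt_of_bilinear
    (hasStrictFDerivAt_id x) (hasStrictFDerivAt_id x)
  have hd' : HasStrictFDerivAt (fun x => B x x) (Le : E →L[ℝ] V) x := by
    refine hd.congr_fderiv ?_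
    ext h
    have hLe : Le h = L h := rfl
    simp [hLe, hL]
  exact hd'.map_nhds_eq_of_equiv

/-- The polynomial `x.1 * X ^ d + ∑ i < d, x.2 i * X ^ i`, with real leading coefficient. -/
noncomputable def coeffPoly (d : ℕ) : (ℝ × (Fin d → ℂ)) →ₗ[ℝ] ℂ[X] where
  toFun x := C (x.1 : ℂ) * X ^ d + ∑ i, C (x.2 i) * X ^ (i : ℕ)
  map_add' x y := by
    simp only [Prod.fst_add, Prod.snd_add, Pi.add_apply, Complex.ofReal_add, C_add, add_mul,
      Finset.sum_add_distrib]
    ring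
  map_smul' r x := by
    simp only [Prod.smul_fst, Prod.smul_snd, Pi.smul_apply, smul_eq_mul, Complex.ofReal_mul,
      Complex.real_smul, RingHom.id_apply, smul_add, Finset.smul_sum]
    have e : ∀ p : ℂ[X], r • p = C (r : ℂ) * p := fun p => by
      ext n
      simp
    simp only [e, C_mul, mul_assoc]

theorem coeffPoly_apply (d : ℕ) (x : ℝ × (Fin d → ℂ)) :
    coeffPoly d x = C (x.1 : ℂ) * X ^ d + ∑ i, C (x.2 i) * X ^ (i : ℕ) := rfl

theorem coeffPoly_coeff_self (d : ℕ) (x : ℝ × (Fin d → ℂ)) : (coeffPoly d x).coeff d = x.1 := by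
  rw [coeffPoly_apply, coeff_add, finsetSum_coeff, Finset.sum_eq_zero]
  · simp
  · intro i _
    rw [coeff_C_mul_X_pow, if_neg i.2.ne']

theorem coeffPoly_coeff (d : ℕ) (x : ℝ × (Fin d → ℂ)) (i : Fin d) :
    (coeffPoly d x).coeff i = x.2 i := by
  rw [coeffPoly_apply, coeff_add, finsetSum_coeff, Finset.sum_eq_single i]
  · rw [coeff_C_mul_X_pow, coeff_C_mul_X_pow, if_neg i.2.ne, if_pos rfl, zero_add]
  · intro j _ hj
    rw [coeff_C_mul_X_pow, if_neg fun h => hj (Fin.ext h.symm)]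
  · simp

theorem coeffPoly_injective (d : ℕ) : Function.Injective (coeffPoly d) := fun x y h => by
  refine Prod.ext ?_ (funext fun i => ?_)
  · have := congrArg (fun p => coeff p d) h
    simpa [coeffPoly_coeff_self] using this
  · rw [← coeffPoly_coeff, h, coeffPoly_coeff]

theorem natDegree_coeffPoly_le (d : ℕ) (x : ℝ × (Fin d → ℂ)) : (coeffPoly d x).natDegree ≤ d := by
  rw [coeffPoly_apply]
  refine (natDegree_add_le _ _).trans (max_le (natDegree_C_mul_X_pow_le _ _) ?_)
  exact natDegree_sum_le_of_forall_le _ _ fun i _ =>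
    (natDegree_C_mul_X_pow_le _ _).trans i.2.le

theorem exists_coeffPoly_eq {d : ℕ} {p : ℂ[X]} (hp : p.natDegree ≤ d) {s : ℝ}
    (hs : p.coeff d = s) : coeffPoly d (s, fun i => p.coeff i) = p := by
  rw [coeffPoly_apply]
  simp only
  rw [Fin.sum_univ_eq_sum_range (fun i => C (p.coeff i) * X ^ i) d, ← hs, add_comm,
    ← Finset.sum_range_succ (fun i => C (p.coeff i) * X ^ i) d]
  exact (p.as_sum_range_C_mul_X_pow' (by omega)).symm

/-- Coefficient vectors of polynomials with positive leading coefficient and all zeros in the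
open disk. -/
def stableCoeffs (d : ℕ) : Set (ℝ × (Fin d → ℂ)) :=
  {x | 0 < x.1 ∧ ∀ w ∈ Metric.closedBall (0 : ℂ) 1, (x.1 : ℂ) + ∑ i, x.2 i * w ^ (d - i) ≠ 0}

/-- In the coordinate w = 1/z the forbidden zeros range over a compact disk, so nonvanishing there
persists under perturbation of the coefficients. -/
theorem isOpen_stableCoeffs (d : ℕ) : IsOpen (stableCoeffs d) := by
  refine (isOpen_lt continuous_const continuous_fst).inter (isOpen_iff_mem_nhds.2 fun x hx => ?_)
  refine (isCompact_closedBall (0 : ℂ) 1).eventually_forall_of_forall_eventually fun w hw => ?_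
  have hc : Continuous fun z : (ℝ × (Fin d → ℂ)) × ℂ =>
      (z.1.1 : ℂ) + ∑ i, z.1.2 i * z.2 ^ (d - i) := by fun_prop
  exact hc.continuousAt.eventually_ne (hx w hw)

theorem coeffPoly_eval_inv {d : ℕ} (x : ℝ × (Fin d → ℂ)) {w : ℂ} (hw : w ≠ 0) :
    (x.1 : ℂ) + ∑ i, x.2 i * w ^ (d - i) = w ^ d * (coeffPoly d x).eval w⁻¹ := by
  rw [coeffPoly_apply, eval_add, eval_finsetSum, mul_add, Finset.mul_sum]
  congr 1
  · simp only [eval_mul, eval_C, eval_pow, eval_X, inv_pow]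
    field_simp
  · refine Finset.sum_congr rfl fun i _ => ?_
    simp only [eval_mul, eval_C, eval_pow, eval_X, inv_pow]
    rw [pow_sub₀ w hw i.2.le]
    ring

theorem exists_zeroPoly_of_mem_stableCoeffs {d : ℕ} {x : ℝ × (Fin d → ℂ)}
    (hx : x ∈ stableCoeffs d) :
    ∃ S : Multiset ℂ, Multiset.card S = d ∧ (∀ a ∈ S, ‖a‖ < 1) ∧
      coeffPoly d x = C (x.1 : ℂ) * zeroPoly S := by
  have h1 : (coeffPoly d x).coeff d ≠ 0 := by
    rw [coeffPoly_coeff_self]; exact_mod_cast hx.1.ne'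
  have hdeg : (coeffPoly d x).natDegree = d :=
    le_antisymm (natDegree_coeffPoly_le d x) (le_natDegree_of_ne_zero h1)
  have hs := IsAlgClosed.splits (coeffPoly d x)
  refine ⟨(coeffPoly d x).roots, ?_, fun a ha => ?_, ?_⟩
  · rw [← hs.natDegree_eq_card_roots, hdeg]
  · by_contra! hn
    have ha0 : a ≠ 0 := by rintro rfl; norm_num at hn
    refine hx.2 a⁻¹ ?_ ?_
    · rw [mem_closedBall_zero_iff, norm_inv]
      exact inv_le_one_of_one_le₀ hn
    · rw [coeffPoly_eval_inv x (inv_ne_zero ha0), inv_inv, (mem_roots'.1 ha).2.eq_zero, mul_zero]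
  · have h2 := hs.eq_prod_roots
    rwa [leadingCoeff, hdeg, coeffPoly_coeff_self] at h2

theorem exists_mem_stableCoeffs {d : ℕ} {S : Multiset ℂ} (hd : Multiset.card S = d)
    (hS : ∀ a ∈ S, ‖a‖ < 1) {s : ℝ} (hs : 0 < s) :
    ∃ x ∈ stableCoeffs d, coeffPoly d x = C (s : ℂ) * zeroPoly S := by
  set p := C (s : ℂ) * zeroPoly S with hp
  have hdeg : p.natDegree ≤ d := (natDegree_C_mul_le _ _).trans (by rw [natDegree_zeroPoly, hd])
  have hmon : (zeroPoly S).Monic := monic_multiset_prod_of_monic _ _ fun a _ => monic_X_sub_C a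
  have hc : p.coeff d = s := by
    have : (zeroPoly S).coeff d = 1 := by
      rw [← hd, ← natDegree_zeroPoly S]; exact hmon.coeff_natDegree
    rw [hp, coeff_C_mul, this, mul_one]
  have he := exists_coeffPoly_eq hdeg hc
  refine ⟨_, ⟨hs, fun w hw => ?_⟩, he⟩
  rcases eq_or_ne w 0 with rfl | hw0
  · rw [Finset.sum_eq_zero fun i _ => by
      rw [zero_pow (Nat.sub_ne_zero_of_lt i.2), mul_zero], add_zero]
    exact_mod_cast hs.ne'
  · rw [coeffPoly_eval_inv _ hw0, he, hp, eval_mul, eval_C]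
    refine mul_ne_zero (pow_ne_zero _ hw0) (mul_ne_zero (by exact_mod_cast hs.ne') fun h => ?_)
    have h1 := hS _ (zeroPoly_eval_eq_zero_iff.1 h)
    rw [norm_inv] at h1
    exact h1.not_ge ((one_le_inv₀ (norm_pos_iff.2 hw0)).2 (by simpa using hw))

/-- The real bilinear form with `critForm m d z p p = z⁻ᵈ * critPoly m S z`, `p = zeroPoly S`,
on the unit circle. -/
noncomputable def critForm (m d : ℕ) (z : ℂ) (p r : ℂ[X]) : ℝ :=
  ((m - d : ℂ) * p.eval z * conj (r.eval z) + 2 * (z * (derivative p).eval z * conj (r.eval z))).re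

/-- With Q = z^d conj P on the circle, zQ' = dQ - z^d conj(zP'); hence mPQ + zP'Q - zPQ' is z^d((m -
d)|P|² + 2 Re(zP' conj P)). -/
theorem critPoly_eval_eq_critForm (m : ℕ) (S : Multiset ℂ) {z : ℂ} (hz : ‖z‖ = 1) :
    (critPoly m S).eval z =
      critForm m (Multiset.card S) z (zeroPoly S) (zeroPoly S) * z ^ Multiset.card S := by
  have h : z * conj z = 1 := by rw [Complex.mul_conj, Complex.normSq_eq_norm_sq, hz]; simp
  have hre : ∀ (d : ℕ) (p : ℂ[X]), (critForm m d z p p : ℂ) =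
      (m - d) * p.eval z * conj (p.eval z) + z * (derivative p).eval z * conj (p.eval z) +
        conj z * conj ((derivative p).eval z) * p.eval z := fun d p => by
    rw [critForm, Complex.re_eq_add_conj]
    simp only [map_add, map_mul, map_sub, map_natCast, Complex.conj_conj, map_ofNat]
    ring
  rw [hre]
  induction S using Multiset.induction_on with
  | empty => simp
  | cons a S ih =>
    have e : (z - a) * (1 - conj a * z) = z * (z - a) * (conj z - conj a) := by
      linear_combination (a - z) * h
    have e2 : (1 - a * conj a) = z * conj z - a * conj a := by rw [h]
    rw [critPoly_cons, eval_add, eval_mul, eval_mul (q := symPoly S), ih, symPoly,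
      eval_mul (q := polePoly S),
      polePoly_eval_of_mem_circle S hz, zeroPoly_cons, Multiset.card_cons, e2]
    simp only [eval_mul, eval_sub, eval_X, eval_C, eval_one, derivative_mul,
      derivative_X, derivative_C, eval_add, map_mul, map_sub, map_add, e, sub_zero,
      one_mul, Nat.cast_add, Nat.cast_one, pow_succ]
    ring

theorem critForm_smul (m d : ℕ) (z : ℂ) (s : ℝ) (p : ℂ[X]) :
    critForm m d z (C (s : ℂ) * p) (C (s : ℂ) * p) = s ^ 2 * critForm m d z p p := by
  simp only [critForm, derivative_C_mul, eval_mul, eval_C, map_mul, Complex.conj_ofReal]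
  rw [← Complex.re_ofReal_mul]
  congr 1
  push_cast
  ring

theorem exists_polynomial_critForm (m d : ℕ) {p : ℂ[X]} (hp : p.natDegree ≤ d) :
    ∃ H : ℂ[X], H.natDegree ≤ 2 * d ∧
      ∀ z, ‖z‖ = 1 → H.eval z = critForm m d z p p * z ^ d := by
  set st : ℂ[X] → ℂ[X] := fun r => reflect d (r.map (starRingEnd ℂ)) with hst
  have hdeg : ∀ r : ℂ[X], r.natDegree ≤ d → (st r).natDegree ≤ d := fun r hr =>
    natDegree_reflect_le.trans (max_le le_rfl (natDegree_map_le.trans hr))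
  have hp' : (X * derivative p).natDegree ≤ d := by
    rcases Nat.eq_zero_or_pos p.natDegree with h0 | h0
    · rw [derivative_of_natDegree_zero h0]; simp
    · refine natDegree_mul_le.trans ?_
      have := natDegree_derivative_le p
      rw [natDegree_X]
      omega
  refine ⟨C (m - d : ℂ) * (p * st p) + X * derivative p * st p + p * st (X * derivative p), ?_,
    fun z hz => ?_⟩
  · have h1 := hdeg p hp
    have h2 := hdeg _ hp'
    refine (natDegree_add_le _ _).trans (max_le ((natDegree_add_le _ _).trans (max_le ?_ ?_)) ?_)
    · exact (natDegree_C_mul_le _ _).trans (natDegree_mul_le.trans (by omega))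
    · exact natDegree_mul_le.trans (by omega)
    · exact natDegree_mul_le.trans (by omega)
  · have h : z * conj z = 1 := by rw [Complex.mul_conj, Complex.normSq_eq_norm_sq, hz]; simp
    have h0 : z ≠ 0 := left_ne_zero_of_mul_eq_one h
    have hev : ∀ r : ℂ[X], r.natDegree ≤ d → (st r).eval z = z ^ d * conj (r.eval z) := fun r hr => by
      rw [hst, eval_reflect_map_conj hr h0, inv_eq_of_mul_eq_one_left h]
    simp only [eval_add, eval_mul, eval_C, hev p hp, hev _ hp', eval_X, critForm,
      Complex.re_eq_add_conj]
    simp only [map_add, map_mul, map_sub, map_natCast, Complex.conj_conj, map_ofNat]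
    ring

/-- Sampling at 2d+1 points loses nothing in degree at most 2d, and 2d+1 is also the real dimension
of the coefficient space. -/
theorem critForm_eq_of_eqOn {m d : ℕ} {p : ℂ[X]} {H : ℂ[X]} (hp : p.natDegree ≤ d)
    (hH : H.natDegree ≤ 2 * d) {ζ : Fin (2 * d + 1) → ℂ} (hζ : Function.Injective ζ)
    (hζ1 : ∀ i, ‖ζ i‖ = 1) (h : ∀ i, critForm m d (ζ i) p p * ζ i ^ d = H.eval (ζ i)) {z : ℂ}
    (hz : ‖z‖ = 1) : critForm m d z p p * z ^ d = H.eval z := by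
  obtain ⟨K, hK, hKe⟩ := exists_polynomial_critForm m d hp
  have : K = H := by
    refine eq_of_degree_sub_lt_of_eval_finset_eq (Finset.univ.map ⟨ζ, hζ⟩) ?_ ?_
    · rw [Finset.card_map, Finset.card_univ, Fintype.card_fin]
      refine degree_le_natDegree.trans_lt ?_
      have := natDegree_sub_le_of_le hK hH
      exact_mod_cast Nat.lt_succ_of_le (by simpa using this)
    · intro x hx
      obtain ⟨i, -, rfl⟩ := Finset.mem_map.1 hx
      show K.eval (ζ i) = H.eval (ζ i)
      rw [hKe _ (hζ1 i), h i]
  rw [← hKe z hz, this]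

theorem critForm_zeroPoly_eq {m d : ℕ} {S : Multiset ℂ} (hd : Multiset.card S = d) (s : ℝ) {z : ℂ}
    (hz : ‖z‖ = 1) : critForm m d z (C (s : ℂ) * zeroPoly S) (C (s : ℂ) * zeroPoly S) * z ^ d =
      (C ((s ^ 2 : ℝ) : ℂ) * critPoly m S).eval z := by
  subst hd
  rw [critForm_smul, eval_mul, eval_C, critPoly_eval_eq_critForm m S hz]
  push_cast
  ring

/-- Equal samples give proportional critical polynomials, with factors the squares of the leading
coefficients; uniqueness of the zeros and positivity of those coefficients do the rest. -/
theorem critForm_injOn {m : ℕ} (hm : 1 ≤ m) {d : ℕ} {ζ : Fin (2 * d + 1) → ℂ}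
    (hζ : Function.Injective ζ) (hζ1 : ∀ i, ‖ζ i‖ = 1) :
    Set.InjOn (fun x i => critForm m d (ζ i) (coeffPoly d x) (coeffPoly d x)) (stableCoeffs d) := by
  intro x hx y hy hxy
  obtain ⟨S, hS, hS1, hxS⟩ := exists_zeroPoly_of_mem_stableCoeffs hx
  obtain ⟨T, hT, hT1, hyT⟩ := exists_zeroPoly_of_mem_stableCoeffs hy
  have key : C ((x.1 ^ 2 : ℝ) : ℂ) * critPoly m S = C ((y.1 ^ 2 : ℝ) : ℂ) * critPoly m T := by
    refine polynomial_eq_of_eval_circle fun z hz => ?_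
    rw [← critForm_zeroPoly_eq hS x.1 hz]
    refine critForm_eq_of_eqOn ?_ ?_ hζ hζ1 (fun i => ?_) hz
    · rw [← hxS]; exact natDegree_coeffPoly_le d x
    · exact (natDegree_C_mul_le _ _).trans (by rw [← hT]; exact natDegree_critPoly_le m T)
    · rw [← critForm_zeroPoly_eq hT y.1 (hζ1 i), ← hxS, ← hyT]
      exact congrArg (fun r : ℝ => (r : ℂ) * ζ i ^ d) (congrFun hxy i)
  have hST : S = T := eq_of_critPoly_eq hm hS1 hT1 (hS.trans hT.symm) (pow_pos hx.1 2)
    (pow_pos hy.1 2) key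
  subst hST
  have h1 := C_injective (mul_right_cancel₀ (critPoly_ne_zero_of_mem_disk hm hS1) key)
  have h2 : x.1 = y.1 := by
    have h3 : x.1 ^ 2 = y.1 ^ 2 := by exact_mod_cast h1
    exact (pow_left_inj₀ hx.1.le hy.1.le two_ne_zero).1 h3
  exact coeffPoly_injective d (by rw [hxS, hyT, h2])

/-- `critForm` at finitely many points, as a bilinear map in the coefficients. -/
noncomputable def critBilin (m d : ℕ) {n : ℕ} (ζ : Fin n → ℂ) :
    (ℝ × (Fin d → ℂ)) →ₗ[ℝ] (ℝ × (Fin d → ℂ)) →ₗ[ℝ] (Fin n → ℝ) :=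
  LinearMap.mk₂ ℝ (fun x y i => critForm m d (ζ i) (coeffPoly d x) (coeffPoly d y))
    (fun x y z => by
      ext i
      simp only [critForm, map_add, eval_add, Pi.add_apply, ← Complex.add_re]
      congr 1; ring)
    (fun r x y => by
      have e : ∀ p : ℂ[X], r • p = C (r : ℂ) * p := fun p => by ext n; simp
      ext i
      simp only [critForm, map_smul, e, derivative_C_mul, eval_mul, eval_C, Pi.smul_apply,
        smul_eq_mul, ← Complex.re_ofReal_mul]
      congr 1; ring)
    (fun x y z => by
      ext i
      simp only [critForm, map_add, eval_add, Pi.add_apply, ← Complex.add_re]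
      congr 1; ring)
    (fun r x y => by
      have e : ∀ p : ℂ[X], r • p = C (r : ℂ) * p := fun p => by ext n; simp
      ext i
      simp only [critForm, map_smul, e, eval_mul, eval_C, Pi.smul_apply, map_mul,
        Complex.conj_ofReal, smul_eq_mul, ← Complex.re_ofReal_mul]
      congr 1; ring)

/-- The set of attained critical divisors is open along continuous families. -/
theorem eventually_exists_critPoly_eq {m : ℕ} (hm : 1 ≤ m) {Y : Type*} [TopologicalSpace Y]
    {d : ℕ} {γ : Y → Multiset ℂ} (hγc : ∀ t, Multiset.card (γ t) = d)
    (hγ : ∀ z, Continuous fun t => (zeroPoly (γ t)).eval z) {t₀ : Y} {Z : Multiset ℂ}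
    (hZ : Multiset.card Z = d) (hZ1 : ∀ a ∈ Z, ‖a‖ < 1) {s : ℝ} (hs : 0 < s)
    (h : C (s : ℂ) * critPoly m Z = symPoly (γ t₀)) :
    ∀ᶠ t in 𝓝 t₀, ∃ Z : Multiset ℂ, Multiset.card Z = d ∧ (∀ a ∈ Z, ‖a‖ < 1) ∧
      ∃ s : ℝ, 0 < s ∧ C (s : ℂ) * critPoly m Z = symPoly (γ t) := by
  set ζ : Fin (2 * d + 1) → ℂ := fun i => circle_infinite.natEmbedding _ i with hζd
  have hζ : Function.Injective ζ := fun i j hij => by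
    have := (circle_infinite.natEmbedding _).injective (Subtype.ext hij)
    exact Fin.ext this
  have hζ1 : ∀ i, ‖ζ i‖ = 1 := fun i => (circle_infinite.natEmbedding _ (i : ℕ)).2
  have hζ0 : ∀ i, ζ i ≠ 0 := fun i h0 => by simpa [h0] using hζ1 i
  -- The square root appears because the form is quadratic: scaling the coefficients by √s scales
  -- the critical polynomial by s.
  obtain ⟨x₀, hx₀, hxZ⟩ := exists_mem_stableCoeffs hZ hZ1 (Real.sqrt_pos.2 hs)
  set g : Y → Fin (2 * d + 1) → ℝ := fun t i => ‖(zeroPoly (γ t)).eval (ζ i)‖ ^ 2 with hg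
  have hgc : Continuous g := continuous_pi fun i => ((hγ (ζ i)).norm.pow 2)
  have hsym : ∀ t i, (g t i : ℂ) * ζ i ^ d = (symPoly (γ t)).eval (ζ i) := fun t i => by
    rw [symPoly_eval_of_mem_circle _ (hζ1 i), hγc]
  have hg0 : critBilin m d ζ x₀ x₀ = g t₀ := by
    ext i
    have h1 := critForm_zeroPoly_eq (m := m) hZ (Real.sqrt s) (hζ1 i)
    rw [Real.sq_sqrt hs.le, h, ← hsym, ← hxZ] at h1
    exact_mod_cast mul_right_cancel₀ (pow_ne_zero d (hζ0 i)) h1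
  have hmap := map_nhds_eq_of_quadratic_injOn (V := Fin (2 * d + 1) → ℝ)
    (by simp [Module.finrank_prod, Module.finrank_pi_fintype]; ring) (critBilin m d ζ)
    (isOpen_stableCoeffs d) (critForm_injOn hm hζ hζ1) hx₀
  have hmem : (fun x => critBilin m d ζ x x) '' stableCoeffs d ∈ 𝓝 (g t₀) := by
    rw [← hg0, ← hmap]
    exact image_mem_map ((isOpen_stableCoeffs d).mem_nhds hx₀)
  filter_upwards [hgc.continuousAt.eventually hmem] with t ht
  obtain ⟨x, hx, hxt⟩ := ht
  obtain ⟨S, hS, hS1, hxS⟩ := exists_zeroPoly_of_mem_stableCoeffs hx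
  refine ⟨S, hS, hS1, x.1 ^ 2, pow_pos hx.1 2, polynomial_eq_of_eval_circle fun z hz => ?_⟩
  rw [← critForm_zeroPoly_eq hS x.1 hz]
  refine critForm_eq_of_eqOn ?_ ?_ hζ hζ1 (fun i => ?_) hz
  · rw [← hxS]; exact natDegree_coeffPoly_le d x
  · rw [← hγc t]; exact natDegree_symPoly_le _
  · rw [← hxS, ← hsym, ← congrFun hxt i]
    rfl

end InverseFunction

/-! ### Topology of divisor spaces. -/

section DivisorTopology

open Polynomial ComplexConjugate Topology Filter

namespace IntegralDiv

theorem norm_lt_one {d : ℕ} (D : IntegralDiv openDisk d) : ∀ a ∈ D.points, ‖a‖ < 1 :=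
  fun a ha => mem_ball_zero_iff.1 (D.mem_of_mem a ha)

theorem norm_le_one {d : ℕ} (D : IntegralDiv closedDisk d) : ∀ a ∈ D.points, ‖a‖ ≤ 1 :=
  fun a ha => mem_closedBall_zero_iff.1 (D.mem_of_mem a ha)

theorem norm_eq_one {d : ℕ} (D : IntegralDiv unitCircle d) : ∀ a ∈ D.points, ‖a‖ = 1 :=
  fun a ha => mem_sphere_zero_iff_norm.1 (D.mem_of_mem a ha)

theorem ofTuple_surjective (Ω : Set ℂ) (e : ℕ) : Function.Surjective (ofTuple Ω e) := by
  intro D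
  obtain ⟨l, hl⟩ := Quot.exists_rep D.points
  have hl' : (l : Multiset ℂ) = D.points := hl
  have hlen : l.length = e := by rw [← D.card_eq, ← hl', Multiset.coe_card]
  subst hlen
  refine ⟨fun k => ⟨l.get k, D.mem_of_mem _ ?_⟩, IntegralDiv.ext ?_⟩
  · rw [← hl', Multiset.mem_coe]
    exact l.get_mem k
  · simp only [ofTuple, Fin.univ_val_map]
    rw [List.ofFn_get, hl']

theorem continuous_ofTuple (Ω : Set ℂ) (e : ℕ) : Continuous (ofTuple Ω e) :=
  continuous_coinduced_rng

instance (e : ℕ) : CompactSpace (IntegralDiv closedDisk e) := by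
  have : CompactSpace closedDisk :=
    isCompact_iff_compactSpace.1 (isCompact_closedBall (0 : ℂ) 1)
  refine ⟨?_⟩
  rw [← (ofTuple_surjective closedDisk e).range_eq]
  exact isCompact_range (continuous_ofTuple _ _)

theorem continuous_eval_prod {f : ℂ → ℂ[X]} (hf : ∀ w, Continuous fun a => (f a).eval w)
    (Ω : Set ℂ) (e : ℕ) (w : ℂ) :
    Continuous fun D : IntegralDiv Ω e => (D.points.map f).prod.eval w := by
  refine continuous_coinduced_dom.2 ?_
  simp only [Function.comp_def, ofTuple, Multiset.map_map]
  change Continuous fun x : Fin e → Ω => (∏ k, f (x k)).eval w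
  simp only [eval_prod]
  exact continuous_finsetProd _ fun k _ =>
    (hf w).comp (continuous_subtype_val.comp (continuous_apply k))

theorem continuous_eval_derivative_prod {f : ℂ → ℂ[X]}
    (hf : ∀ w, Continuous fun a => (f a).eval w)
    (hf' : ∀ w, Continuous fun a => (derivative (f a)).eval w) (Ω : Set ℂ) (e : ℕ) (w : ℂ) :
    Continuous fun D : IntegralDiv Ω e => (derivative (D.points.map f).prod).eval w := by
  refine continuous_coinduced_dom.2 ?_
  simp only [Function.comp_def, ofTuple, Multiset.map_map]
  change Continuous fun x : Fin e → Ω => (derivative (∏ k, f (x k))).eval w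
  simp only [derivative_prod_finset, eval_finsetSum, eval_mul, eval_prod]
  refine continuous_finsetSum _ fun k _ => Continuous.mul (continuous_finsetProd _ fun j _ => ?_) ?_
  · exact (hf w).comp (continuous_subtype_val.comp (continuous_apply j))
  · exact (hf' w).comp (continuous_subtype_val.comp (continuous_apply k))

theorem continuous_symPoly_eval (Ω : Set ℂ) (e : ℕ) (w : ℂ) :
    Continuous fun D : IntegralDiv Ω e => (symPoly D.points).eval w := by
  simp only [symPoly, eval_mul]
  refine (continuous_eval_prod (fun w => ?_) Ω e w).mul (continuous_eval_prod (fun w => ?_) Ω e w)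
  · simp only [eval_sub, eval_X, eval_C]; fun_prop
  · simp only [eval_sub, eval_one, eval_mul, eval_X, eval_C]; fun_prop

theorem continuous_critPoly_eval (m : ℕ) (Ω : Set ℂ) (e : ℕ) (w : ℂ) :
    Continuous fun D : IntegralDiv Ω e => (critPoly m D.points).eval w := by
  have h1 : ∀ w, Continuous fun a : ℂ => (X - C a).eval w := fun w => by
    simp only [eval_sub, eval_X, eval_C]; fun_prop
  have h2 : ∀ w, Continuous fun a : ℂ => (1 - C (conj a) * X).eval w := fun w => by
    simp only [eval_sub, eval_one, eval_mul, eval_X, eval_C]; fun_prop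
  have c1 : Continuous fun D : IntegralDiv Ω e => (zeroPoly D.points).eval w :=
    continuous_eval_prod h1 Ω e w
  have c2 : Continuous fun D : IntegralDiv Ω e => (polePoly D.points).eval w :=
    continuous_eval_prod h2 Ω e w
  have c3 : Continuous fun D : IntegralDiv Ω e => (derivative (zeroPoly D.points)).eval w :=
    continuous_eval_derivative_prod h1 (fun w => by simpa using continuous_const) Ω e w
  have c4 : Continuous fun D : IntegralDiv Ω e => (derivative (polePoly D.points)).eval w :=
    continuous_eval_derivative_prod h2 (fun w => by simpa using by fun_prop) Ω e w
  simp only [critPoly, eval_add, eval_mul, eval_sub, eval_C, eval_X]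
  exact (continuous_const.mul (c1.mul c2)).add
    (continuous_const.mul ((c3.mul c2).sub (c1.mul c4)))

theorem toClosed_injective {e : ℕ} : Function.Injective (toClosed (e := e)) :=
  fun _ _ h => IntegralDiv.ext (congrArg (fun E : IntegralDiv closedDisk e => E.points) h)

/-- A quotient topology need not restrict well to a subset. Here it does, since every tuple
representing an open-disk divisor lies in the open polydisk, so saturated open sets stay open. -/
theorem isOpenEmbedding_toClosed (e : ℕ) : IsOpenEmbedding (toClosed (e := e)) := by
  have hsub : openDisk ⊆ closedDisk := Metric.ball_subset_closedBall
  have hj : (toClosed ∘ ofTuple openDisk e) =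
      ofTuple closedDisk e ∘ Pi.map fun _ => Set.inclusion hsub := rfl
  refine .of_continuous_injective_isOpenMap ?_ toClosed_injective fun U hU => ?_
  · refine continuous_coinduced_dom.2 ?_
    rw [hj]
    exact (continuous_ofTuple _ _).comp
      (Continuous.piMap fun _ => continuous_inclusion hsub)
  · refine isOpen_coinduced.2 ?_
    have e1 : ofTuple closedDisk e ⁻¹' (toClosed '' U) =
        (Pi.map fun _ : Fin e => Set.inclusion hsub) '' (ofTuple openDisk e ⁻¹' U) := by
      ext z
      constructor
      · rintro ⟨D, hD, hz⟩
        have hm : ∀ k, (z k : ℂ) ∈ openDisk := fun k => by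
          refine D.mem_of_mem _ ?_
          have : D.points = (ofTuple closedDisk e z).points := congrArg points hz
          rw [this]
          exact Multiset.mem_map_of_mem (fun k => (z k : ℂ)) (Finset.mem_univ_val k)
        refine ⟨fun k => ⟨z k, hm k⟩, ?_, rfl⟩
        have : ofTuple openDisk e (fun k => ⟨z k, hm k⟩) = D := toClosed_injective hz.symm
        rw [Set.mem_preimage, this]
        exact hD
      · rintro ⟨w, hw, rfl⟩
        exact ⟨_, hw, rfl⟩
    rw [e1]
    refine IsOpenMap.piMap (fun _ => Metric.isOpen_ball.isOpenMap_inclusion hsub)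
      (by simp) _ (hU.preimage (continuous_ofTuple _ _))

end IntegralDiv

/-- The preimage of K is the projection of graph ∩ (X × K) along the compact factor, which is a
closed map. No separation axiom on divisor spaces is needed. -/
theorem continuous_of_isClosed_graph_of_compactSpace {X Y : Type*} [TopologicalSpace X]
    [TopologicalSpace Y] [CompactSpace Y] {f : X → Y} (hf : IsClosed {p : X × Y | f p.1 = p.2}) :
    Continuous f := by
  refine continuous_iff_isClosed.2 fun K hK => ?_
  have : f ⁻¹' K = Prod.fst '' ({p : X × Y | f p.1 = p.2} ∩ Prod.snd ⁻¹' K) := by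
    ext x
    constructor
    · exact fun hx => ⟨(x, f x), ⟨rfl, hx⟩, rfl⟩
    · rintro ⟨⟨x, y⟩, ⟨hxy, hy⟩, rfl⟩
      exact Set.mem_preimage.2 (by rwa [show f x = y from hxy])
  rw [this]
  exact isClosedMap_fst_of_compactSpace _ (hf.inter (hK.preimage continuous_snd))

theorem exists_equiv_of_existsUnique {α β : Type*} {R : α → β → Prop} (h₁ : ∀ a, ∃! b, R a b)
    (h₂ : ∀ b, ∃! a, R a b) : ∃ e : α ≃ β, ∀ a b, e a = b ↔ R a b := by
  choose f hf hf' using h₁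
  have hb : Function.Bijective f := by
    refine ⟨fun a a' h => (h₂ (f a)).unique (hf a) (h ▸ hf a'), fun b => ?_⟩
    obtain ⟨a, ha, -⟩ := h₂ b
    exact ⟨a, (hf' a b ha).symm⟩
  refine ⟨Equiv.ofBijective f hb, fun a b => ⟨?_, fun h => (hf' a b h).symm⟩⟩
  rintro rfl
  exact hf a

end DivisorTopology

/-! ### The critical-divisor relation on the closed disk; existence of Blaschke products. -/

section CriticalDivisor

open Polynomial ComplexConjugate Topology Filter

/-- `T` is the free critical divisor of the Blaschke product with free zero divisor `S`; points
on the unit circle are allowed in both. -/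
def IsCritDiv (m : ℕ) (S T : Multiset ℂ) : Prop :=
  ∃ c : ℂ, c ≠ 0 ∧ critPoly m S = C c * symPoly T

theorem IsCritDiv.add {m : ℕ} {S T B : Multiset ℂ} (h : IsCritDiv m S T)
    (hB : ∀ b ∈ B, ‖b‖ = 1) : IsCritDiv m (S + B) (T + B) := by
  obtain ⟨c, hc, h⟩ := h
  refine ⟨c, hc, ?_⟩
  rw [critPoly_add_of_mem_circle m S B hB, h, symPoly_add]
  ring

theorem exists_disk_add_circle {S : Multiset ℂ} (hS : ∀ a ∈ S, ‖a‖ ≤ 1) :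
    ∃ S₀ B : Multiset ℂ, S = S₀ + B ∧ (∀ a ∈ S₀, ‖a‖ < 1) ∧ ∀ b ∈ B, ‖b‖ = 1 := by
  classical
  refine ⟨S.filter fun a => ‖a‖ < 1, S.filter fun a => ¬ ‖a‖ < 1,
    (Multiset.filter_add_not _ _).symm, fun a ha => (Multiset.mem_filter.1 ha).2, fun b hb => ?_⟩
  obtain ⟨h1, h2⟩ := Multiset.mem_filter.1 hb
  exact le_antisymm (hS b h1) (not_lt.1 h2)

theorem disk_add_circle_unique {S T B B' : Multiset ℂ} (hS : ∀ a ∈ S, ‖a‖ < 1)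
    (hT : ∀ a ∈ T, ‖a‖ < 1) (hB : ∀ a ∈ B, ‖a‖ = 1) (hB' : ∀ a ∈ B', ‖a‖ = 1)
    (h : S + B = T + B') : S = T ∧ B = B' := by
  classical
  have h1 := congrArg (Multiset.filter fun a => ‖a‖ < 1) h
  simp only [Multiset.filter_add] at h1
  rw [Multiset.filter_eq_self.2 hS, Multiset.filter_eq_self.2 hT,
    Multiset.filter_eq_nil.2 fun b hb => by simp [hB b hb],
    Multiset.filter_eq_nil.2 fun b hb => by simp [hB' b hb], add_zero, add_zero] at h1
  exact ⟨h1, add_left_cancel (h1 ▸ h)⟩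

theorem critPoly_ne_zero {m : ℕ} (hm : 1 ≤ m) {S : Multiset ℂ} (hS : ∀ a ∈ S, ‖a‖ ≤ 1) :
    critPoly m S ≠ 0 := by
  obtain ⟨S₀, B, rfl, h0, hB⟩ := exists_disk_add_circle hS
  rw [critPoly_add_of_mem_circle m S₀ B hB]
  exact mul_ne_zero (symPoly_ne_zero B) (critPoly_ne_zero_of_mem_disk hm h0)

theorem critPoly_eval_one_pos {m : ℕ} (hm : 1 ≤ m) {S : Multiset ℂ} (hS : ∀ a ∈ S, ‖a‖ < 1) :
    ∃ r : ℝ, 0 < r ∧ (critPoly m S).eval 1 = r := by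
  obtain ⟨κ, -, -, hp, hb⟩ := exists_defect_quotient hm hS
  exact ⟨κ 1, hp 1 (by simp), by simpa using hb 1 (by simp)⟩

theorem symPoly_eval_one_pos {S : Multiset ℂ} (hS : ∀ a ∈ S, ‖a‖ < 1) :
    ∃ r : ℝ, 0 < r ∧ (symPoly S).eval 1 = r := by
  refine ⟨‖(zeroPoly S).eval 1‖ ^ 2, ?_, by
    simpa using symPoly_eval_of_mem_circle S (z := 1) (by simp)⟩
  have : (zeroPoly S).eval 1 ≠ 0 := fun h => by
    simpa using hS 1 (zeroPoly_eval_eq_zero_iff.1 h)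
  positivity

/-- Cross-multiplying eliminates the constant c, so the relation becomes a closed condition on the
pair of divisors. Nonvanishing of `critPoly` makes c nonzero again. -/
theorem isCritDiv_iff {m : ℕ} (hm : 1 ≤ m) {S T : Multiset ℂ} (hS : ∀ a ∈ S, ‖a‖ ≤ 1) :
    IsCritDiv m S T ↔ ∀ z w, (critPoly m S).eval z * (symPoly T).eval w =
      (critPoly m S).eval w * (symPoly T).eval z := by
  constructor
  · rintro ⟨c, -, h⟩ z w
    rw [h, eval_mul, eval_mul, eval_C, eval_C]
    ring
  · intro h
    obtain ⟨w, hw⟩ : ∃ w, (symPoly T).eval w ≠ 0 := by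
      by_contra! hcon
      exact symPoly_ne_zero T (Polynomial.funext fun w => by simpa using hcon w)
    have e : critPoly m S = C ((critPoly m S).eval w / (symPoly T).eval w) * symPoly T :=
      Polynomial.funext fun z => by
        rw [eval_mul, eval_C, div_mul_eq_mul_div, eq_div_iff hw, h z w]
    refine ⟨_, fun h0 => ?_, e⟩
    rw [h0, C_0, zero_mul] at e
    exact critPoly_ne_zero hm hS e

theorem IsCritDiv.right_unique {m : ℕ} {S T T' : Multiset ℂ} (hT : ∀ a ∈ T, ‖a‖ ≤ 1)
    (hT' : ∀ a ∈ T', ‖a‖ ≤ 1) (h : IsCritDiv m S T) (h' : IsCritDiv m S T') : T = T' := by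
  obtain ⟨c, hc, h⟩ := h
  obtain ⟨c', hc', h'⟩ := h'
  refine eq_of_symPoly_eq hT hT' (c := c⁻¹ * c') (mul_ne_zero (inv_ne_zero hc) hc') ?_
  rw [C_mul, mul_assoc, ← h', h, ← mul_assoc, ← C_mul, inv_mul_cancel₀ hc, C_1, one_mul]

theorem exists_isCritDiv {m : ℕ} (hm : 1 ≤ m) {S : Multiset ℂ} (hS : ∀ a ∈ S, ‖a‖ < 1) :
    ∃ T : Multiset ℂ, Multiset.card T = Multiset.card S ∧ (∀ a ∈ T, ‖a‖ < 1) ∧ IsCritDiv m S T := by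
  obtain ⟨T, c, h1, h2, h3, h4⟩ := exists_critPoly_eq hm hS
  exact ⟨T, h1, h2, c, h3, h4⟩

/-- Interior critical divisors come from interior zero divisors, with a positive constant. -/
theorem IsCritDiv.exists_pos {m : ℕ} (hm : 1 ≤ m) {S T : Multiset ℂ} (hS : ∀ a ∈ S, ‖a‖ ≤ 1)
    (hT : ∀ a ∈ T, ‖a‖ < 1) (h : IsCritDiv m S T) :
    (∀ a ∈ S, ‖a‖ < 1) ∧ ∃ s : ℝ, 0 < s ∧ C (s : ℂ) * critPoly m S = symPoly T := by
  have hS' : ∀ a ∈ S, ‖a‖ < 1 := by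
    obtain ⟨c, hc, h⟩ := h
    obtain ⟨S₀, B, rfl, h0, hB⟩ := exists_disk_add_circle hS
    intro a ha
    rcases Multiset.mem_add.1 ha with ha | ha
    · exact h0 a ha
    · have h1 := congrArg (eval a) h
      have hz : (zeroPoly B).eval a = 0 := zeroPoly_eval_eq_zero_iff.2 ha
      rw [critPoly_add_of_mem_circle m S₀ B hB, eval_mul, symPoly_eval_of_mem_circle B (hB a ha),
        hz, eval_mul, eval_C, symPoly_eval_of_mem_circle T (hB a ha)] at h1
      have ha0 : a ≠ 0 := by rintro rfl; simpa using hB _ ha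
      have h2 : (zeroPoly T).eval a = 0 := by simpa [hc, ha0] using h1
      exact hT a (zeroPoly_eval_eq_zero_iff.1 h2)
  refine ⟨hS', ?_⟩
  obtain ⟨c, hc, h⟩ := h
  -- Both polynomials are positive at 1, so the proportionality constant is positive.
  obtain ⟨r, hr, hr'⟩ := critPoly_eval_one_pos hm hS'
  obtain ⟨t, ht, ht'⟩ := symPoly_eval_one_pos hT
  have h1 := congrArg (eval 1) h
  rw [eval_mul, eval_C, hr', ht'] at h1
  have h2 : (t : ℂ) ≠ 0 := by exact_mod_cast ht.ne'
  refine ⟨t / r, div_pos ht hr, ?_⟩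
  rw [h, ← mul_assoc, ← C_mul]
  push_cast
  rw [h1, div_mul_eq_mul_div, mul_comm c, div_self (mul_ne_zero h2 hc), C_1, one_mul]

theorem IsCritDiv.left_unique {m : ℕ} (hm : 1 ≤ m) {S S' T : Multiset ℂ}
    (hS : ∀ a ∈ S, ‖a‖ < 1) (hS' : ∀ a ∈ S', ‖a‖ < 1) (hT : ∀ a ∈ T, ‖a‖ < 1)
    (hc : Multiset.card S = Multiset.card S') (h : IsCritDiv m S T) (h' : IsCritDiv m S' T) :
    S = S' := by
  obtain ⟨-, s, hs, e⟩ := h.exists_pos hm (fun a ha => (hS a ha).le) hT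
  obtain ⟨-, s', hs', e'⟩ := h'.exists_pos hm (fun a ha => (hS' a ha).le) hT
  exact eq_of_critPoly_eq hm hS hS' hc hs hs' (e.trans e'.symm)

theorem critPoly_replicate_zero (m d : ℕ) :
    critPoly m (Multiset.replicate d 0) =
      C ((m + d : ℕ) : ℂ) * symPoly (Multiset.replicate d 0) := by
  have hp : polePoly (Multiset.replicate d 0) = 1 := by simp [polePoly]
  have hz : zeroPoly (Multiset.replicate d 0) = X ^ d := by simp [zeroPoly]
  rw [critPoly, symPoly, hp, hz]
  rcases d with _ | d
  · simp
  · simp only [derivative_X_pow, derivative_one, Nat.add_sub_cancel, Nat.cast_add, Nat.cast_one,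
      map_add, C_1]
    ring

/-- Heins: every divisor in the open disk is the free critical divisor of a Blaschke product. -/
theorem exists_isCritDiv_left {m : ℕ} (hm : 1 ≤ m) {T : Multiset ℂ} (hT : ∀ a ∈ T, ‖a‖ < 1) :
    ∃ S : Multiset ℂ, Multiset.card S = Multiset.card T ∧ (∀ a ∈ S, ‖a‖ < 1) ∧ IsCritDiv m S T := by
  set d := Multiset.card T with hd
  set γ : unitInterval → Multiset ℂ := fun t => T.map fun a => (t : ℂ) * a with hγ
  have hγc : ∀ t, Multiset.card (γ t) = d := fun t => by simp [hγ, hd]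
  have hγ1 : ∀ t, ∀ a ∈ γ t, ‖a‖ < 1 := fun t a ha => by
    obtain ⟨b, hb, rfl⟩ := Multiset.mem_map.1 ha
    have h1 := hT b hb
    have h2 := t.2.1
    have h3 := t.2.2
    rw [norm_mul, Complex.norm_real, Real.norm_of_nonneg h2]
    nlinarith [norm_nonneg b]
  have hzc : ∀ z, Continuous fun t => (zeroPoly (γ t)).eval z := fun z => by
    simp only [zeroPoly, hγ, Multiset.map_map, eval_multiset_prod, Function.comp_def]
    refine continuous_multiset_prod T fun a _ => ?_
    simp only [eval_sub, eval_X, eval_C]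
    fun_prop
  have hpc : ∀ z, Continuous fun t => (polePoly (γ t)).eval z := fun z => by
    simp only [polePoly, hγ, Multiset.map_map, eval_multiset_prod, Function.comp_def]
    refine continuous_multiset_prod T fun a _ => ?_
    simp only [eval_sub, eval_X, eval_C, eval_mul, eval_one, map_mul, Complex.conj_ofReal]
    fun_prop
  set I : Set unitInterval := {t | ∃ S : Multiset ℂ, Multiset.card S = d ∧ (∀ a ∈ S, ‖a‖ < 1) ∧
    ∃ s : ℝ, 0 < s ∧ C (s : ℂ) * critPoly m S = symPoly (γ t)} with hI
  have hopen : IsOpen I := isOpen_iff_mem_nhds.2 fun t ⟨S, hS, hS1, s, hs, h⟩ =>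
    eventually_exists_critPoly_eq hm hγc hzc hS hS1 hs h
  -- Allowing zeros in the closed disk makes the fibre compact, so I is closed. Nothing is gained by
  -- this: `exists_pos` rules out circle zeros when the critical divisor is interior.
  have hIe : I = Prod.fst '' {p : unitInterval × IntegralDiv closedDisk d |
      ∀ z w, (critPoly m p.2.points).eval z * (symPoly (γ p.1)).eval w =
        (critPoly m p.2.points).eval w * (symPoly (γ p.1)).eval z} := by
    ext t
    constructor
    · rintro ⟨S, hS, hS1, s, hs, h⟩
      refine ⟨(t, ⟨S, fun q hq => mem_closedBall_zero_iff.2 (hS1 q hq).le, hS⟩), fun z w => ?_, rfl⟩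
      simp only [← h, eval_mul, eval_C]
      ring
    · rintro ⟨⟨t, D⟩, h, rfl⟩
      obtain ⟨h1, h2⟩ := ((isCritDiv_iff hm D.norm_le_one).2 h).exists_pos hm D.norm_le_one (hγ1 t)
      exact ⟨D.points, D.card_eq, h1, h2⟩
  have hclosed : IsClosed I := by
    rw [hIe]
    refine isClosedMap_fst_of_compactSpace _ ?_
    simp only [Set.ofPred_forall]
    refine isClosed_iInter fun z => isClosed_iInter fun w => isClosed_eq ?_ ?_
    all_goals
      refine ((IntegralDiv.continuous_critPoly_eval m closedDisk d _).comp continuous_snd).mul ?_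
      simp only [symPoly, eval_mul]
      exact ((hzc _).comp continuous_fst).mul ((hpc _).comp continuous_fst)
  -- At t = 0 the solution is f = z^(m+d), whose critical points all lie at 0.
  have h0 : (0 : unitInterval) ∈ I := by
    have hm0 : (0 : ℝ) < (m + d : ℕ) := by exact_mod_cast (by omega : 0 < m + d)
    refine ⟨Multiset.replicate d 0, Multiset.card_replicate _ _, fun a ha => ?_,
      ((m + d : ℕ) : ℝ)⁻¹,
      inv_pos.2 hm0, ?_⟩
    · rw [Multiset.eq_of_mem_replicate ha]; simp
    · have : γ 0 = Multiset.replicate d 0 := by simp [hγ, hd]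
      rw [this, critPoly_replicate_zero, ← mul_assoc, ← C_mul]
      have h2 : ((m + d : ℕ) : ℂ) ≠ 0 := by exact_mod_cast hm0.ne'
      rw [Complex.ofReal_inv, Complex.ofReal_natCast, inv_mul_cancel₀ h2, C_1, one_mul]
  have h1 : (1 : unitInterval) ∈ I := by
    rw [IsClopen.eq_univ ⟨hclosed, hopen⟩ ⟨0, h0⟩]; trivial
  obtain ⟨S, hS, hS1, s, hs, h⟩ := h1
  have e1 : γ 1 = T := by simp [hγ]
  rw [e1] at h
  have hs0 : (s : ℂ) ≠ 0 := by exact_mod_cast hs.ne'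
  refine ⟨S, hS, hS1, (s : ℂ)⁻¹, inv_ne_zero hs0, ?_⟩
  rw [← h, ← mul_assoc, ← C_mul, inv_mul_cancel₀ hs0, C_1, one_mul]

end CriticalDivisor

/-! ### From local degrees to roots of the critical polynomial. -/

section Ramification

open Polynomial ComplexConjugate Topology Filter

theorem blaschke_eq_div (m : ℕ) {d : ℕ} (Z : IntegralDiv openDisk d) (z : ℂ) :
    blaschke m Z z = (Z.points.map fun a => (1 - conj a) / (1 - a)).prod *
      ((X ^ m * zeroPoly Z.points).eval z / (polePoly Z.points).eval z) := by
  have h : ∀ S : Multiset ℂ,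
      (S.map fun a => (1 - conj a) / (1 - a) * ((z - a) / (1 - conj a * z))).prod =
        (S.map fun a => (1 - conj a) / (1 - a)).prod *
          ((zeroPoly S).eval z / (polePoly S).eval z) := fun S => by
    rw [Multiset.prod_map_mul, Multiset.prod_map_div (f := fun a => z - a)]
    simp [zeroPoly, polePoly, eval_multiset_prod]
  rw [blaschke, h, eval_mul, eval_pow, eval_X]
  ring

theorem prod_one_sub_conj_div_ne_zero {d : ℕ} (Z : IntegralDiv openDisk d) :
    (Z.points.map fun a => (1 - conj a) / (1 - a)).prod ≠ 0 := by
  refine Multiset.prod_ne_zero fun h => ?_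
  obtain ⟨a, ha, h⟩ := Multiset.mem_map.1 h
  have h1 := Z.norm_lt_one a ha
  rcases div_eq_zero_iff.1 h with h | h
  · have h2 : ‖conj a‖ = 1 := by rw [← sub_eq_zero.1 h]; simp
    rw [RCLike.norm_conj] at h2
    exact h1.ne h2
  · rw [← sub_eq_zero.1 h] at h1
    simp at h1

theorem analyticAt_polynomial_eval (p : ℂ[X]) (q : ℂ) : AnalyticAt ℂ (fun z => p.eval z) q :=
  (p.differentiable.analyticAt q)

/-- The order of f - f(q) at q is one more than that of f', and f' is z^(m-1) `critPoly` over a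
denominator that does not vanish in the disk. -/
theorem localDegree_blaschke {m : ℕ} (hm : 1 ≤ m) {d : ℕ} (Z : IntegralDiv openDisk d) {q : ℂ}
    (hq : ‖q‖ < 1) : localDegree (blaschke m Z) q =
      (X ^ (m - 1) * critPoly m Z.points).rootMultiplicity q + 1 := by
  set u := (Z.points.map fun a => (1 - conj a) / (1 - a)).prod with hu
  set P := X ^ m * zeroPoly Z.points with hP
  set Q := polePoly Z.points with hQ
  have hQ0 : ∀ z, ‖z‖ < 1 → Q.eval z ≠ 0 := fun z hz =>
    polePoly_eval_ne_zero Z.norm_lt_one hz.le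
  have hf : blaschke m Z = fun z => u * (P.eval z / Q.eval z) := funext (blaschke_eq_div m Z)
  have hfa : AnalyticAt ℂ (blaschke m Z) q := by
    rw [hf]
    exact analyticAt_const.mul
      ((analyticAt_polynomial_eval P q).div (analyticAt_polynomial_eval Q q) (hQ0 q hq))
  have hp0 : X ^ (m - 1) * critPoly m Z.points ≠ 0 :=
    mul_ne_zero (pow_ne_zero _ X_ne_zero) (critPoly_ne_zero_of_mem_disk hm Z.norm_lt_one)
  obtain ⟨r, hr, hr'⟩ := exists_eq_pow_rootMultiplicity_mul_and_not_dvd _ hp0 q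
  set n := (X ^ (m - 1) * critPoly m Z.points).rootMultiplicity q
  have hd : analyticOrderAt (deriv (blaschke m Z)) q = n := by
    rw [hfa.deriv.analyticOrderAt_eq_natCast]
    refine ⟨fun z => u * (r.eval z / Q.eval z ^ 2), ?_, ?_, ?_⟩
    · exact analyticAt_const.mul ((analyticAt_polynomial_eval r q).div
        ((analyticAt_polynomial_eval Q q).pow 2) (pow_ne_zero 2 (hQ0 q hq)))
    · refine mul_ne_zero (prod_one_sub_conj_div_ne_zero Z) (div_ne_zero (fun h => hr' ?_)
        (pow_ne_zero 2 (hQ0 q hq)))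
      exact dvd_iff_isRoot.2 h
    · filter_upwards [Metric.isOpen_ball.mem_nhds
        (show q ∈ Metric.ball (0 : ℂ) 1 by simpa using hq)] with z hz
      have hz' := hQ0 z (by simpa using hz)
      have h1 := (((P.hasDerivAt z).fun_div (Q.hasDerivAt z) hz').const_mul u).deriv
      have h2 := congrArg (eval z) ((derivative_mul_sub_eq_critPoly hm Z.points).trans hr)
      simp only [← hP, ← hQ, eval_sub, eval_mul, eval_pow, eval_X, eval_C] at h2
      rw [hf, h1, smul_eq_mul]
      rw [h2]
      ring
  have h1 := hfa.analyticOrderAt_deriv_add_one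
  rw [hd] at h1
  rw [localDegree, analyticOrderNatAt, ← h1]
  rfl

theorem mult_eq_freeRamification {m : ℕ} (hm : 1 ≤ m) {d : ℕ} {Z D : IntegralDiv openDisk d}
    (h : IsCritDiv m Z.points D.points) (q : ℂ) :
    D.mult q = freeRamification m (blaschke m Z) q := by
  classical
  by_cases hq : q ∈ openDisk
  · have hq' : ‖q‖ < 1 := mem_ball_zero_iff.1 hq
    obtain ⟨c, hc, h⟩ := h
    have h1 : (critPoly m Z.points).rootMultiplicity q = D.points.count q := by
      rw [h, rootMultiplicity_mul (mul_ne_zero (C_ne_zero.2 hc) (symPoly_ne_zero _)),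
        rootMultiplicity_C, symPoly, rootMultiplicity_mul (symPoly_ne_zero _),
        rootMultiplicity_zeroPoly,
        rootMultiplicity_polePoly_of_mem_disk (fun a ha => (D.norm_lt_one a ha).le) hq']
      omega
    have h2 : (X ^ (m - 1) : ℂ[X]).rootMultiplicity q = if q = 0 then m - 1 else 0 := by
      split_ifs with h0
      · subst h0
        simpa using rootMultiplicity_X_sub_C_pow (0 : ℂ) (m - 1)
      · exact rootMultiplicity_eq_zero (by simp [h0])
    have h3 : D.mult q = (D.points.count q : ℤ) := by
      unfold IntegralDiv.mult
      congr!
    rw [freeRamification, ramification, if_pos hq, localDegree_blaschke hm Z hq',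
      rootMultiplicity_mul (mul_ne_zero (pow_ne_zero _ X_ne_zero)
        (critPoly_ne_zero_of_mem_disk hm Z.norm_lt_one)), h1, h2, h3]
    split_ifs <;> push_cast [hm] <;> ring
  · have h0 : q ≠ 0 := by
      rintro rfl
      exact hq (by simp [openDisk])
    have h1 : q ∉ D.points := fun hm => hq (D.mem_of_mem q hm)
    rw [freeRamification, ramification, if_neg hq, if_neg h0, IntegralDiv.mult,
      Multiset.count_eq_zero.2 h1]
    simp

end Ramification

/-! ### Bijections, continuity and the extension theorem. -/

section Main

open Topology

theorem exists_equiv_openDisk {m : ℕ} (hm : 1 ≤ m) (d : ℕ) :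
    ∃ ψ : IntegralDiv openDisk d ≃ IntegralDiv openDisk d,
      ∀ Z C, ψ Z = C ↔ IsCritDiv m Z.points C.points := by
  refine exists_equiv_of_existsUnique
    (R := fun Z C : IntegralDiv openDisk d => IsCritDiv m Z.points C.points)
    (fun Z => ?_) (fun C => ?_)
  · obtain ⟨T, hc, hT, h⟩ := exists_isCritDiv hm Z.norm_lt_one
    refine ⟨⟨T, fun q hq => mem_ball_zero_iff.2 (hT q hq), hc.trans Z.card_eq⟩, h,
      fun D hD => IntegralDiv.ext ?_⟩
    exact IsCritDiv.right_unique (fun a ha => (D.norm_lt_one a ha).le) (fun a ha => (hT a ha).le) hD h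
  · obtain ⟨S, hc, hS, h⟩ := exists_isCritDiv_left hm C.norm_lt_one
    refine ⟨⟨S, fun q hq => mem_ball_zero_iff.2 (hS q hq), hc.trans C.card_eq⟩, h,
      fun D hD => IntegralDiv.ext ?_⟩
    exact IsCritDiv.left_unique hm D.norm_lt_one hS C.norm_lt_one
      (by rw [D.card_eq, hc, C.card_eq]) hD h

theorem exists_equiv_closedDisk {m : ℕ} (hm : 1 ≤ m) (e : ℕ) :
    ∃ φ : IntegralDiv closedDisk e ≃ IntegralDiv closedDisk e,
      ∀ Z C, φ Z = C ↔ IsCritDiv m Z.points C.points := by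
  refine exists_equiv_of_existsUnique
    (R := fun Z C : IntegralDiv closedDisk e => IsCritDiv m Z.points C.points)
    (fun Z => ?_) (fun C => ?_)
  · obtain ⟨S, B, hZ, hS, hB⟩ := exists_disk_add_circle Z.norm_le_one
    obtain ⟨T, hc, hT, h⟩ := exists_isCritDiv hm hS
    have hTB : ∀ q ∈ T + B, ‖q‖ ≤ 1 := fun q hq =>
      (Multiset.mem_add.1 hq).elim (fun h => (hT q h).le) fun h => (hB q h).le
    have h' := h.add hB
    rw [← hZ] at h'
    refine ⟨⟨T + B, fun q hq => mem_closedBall_zero_iff.2 (hTB q hq), ?_⟩, h',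
      fun D hD => IntegralDiv.ext (IsCritDiv.right_unique D.norm_le_one hTB hD h')⟩
    rw [Multiset.card_add, hc, ← Multiset.card_add, ← hZ, Z.card_eq]
  · obtain ⟨T, B, hC, hT, hB⟩ := exists_disk_add_circle C.norm_le_one
    obtain ⟨S, hc, hS, h⟩ := exists_isCritDiv_left hm hT
    have hSB : ∀ q ∈ S + B, ‖q‖ ≤ 1 := fun q hq =>
      (Multiset.mem_add.1 hq).elim (fun h => (hS q h).le) fun h => (hB q h).le
    have h' := h.add hB
    rw [← hC] at h'
    have hcard : Multiset.card (S + B) = e := by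
      rw [Multiset.card_add, hc, ← Multiset.card_add, ← hC, C.card_eq]
    refine ⟨⟨S + B, fun q hq => mem_closedBall_zero_iff.2 (hSB q hq), hcard⟩, h',
      fun D hD => IntegralDiv.ext ?_⟩
    -- For uniqueness of the zeros, split a competitor as S' + B'. Its critical divisor is T' + B'
    -- with T' interior, so comparison with T + B forces B' = B and T' = T, and the open-disk case
    -- applies.
    obtain ⟨S', B', hD', hS', hB'⟩ := exists_disk_add_circle D.norm_le_one
    obtain ⟨T', hc', hT', h''⟩ := exists_isCritDiv hm hS'
    have h3 := h''.add hB'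
    rw [← hD'] at h3
    have h4 := IsCritDiv.right_unique (fun q hq => (Multiset.mem_add.1 hq).elim
      (fun h => (hT' q h).le) fun h => (hB' q h).le) C.norm_le_one h3 hD
    obtain ⟨rfl, rfl⟩ := disk_add_circle_unique hT' hT hB' hB (h4.trans hC)
    rw [hD', IsCritDiv.left_unique hm hS' hS hT (by rw [← hc', hc]) h'' h]

theorem continuous_of_isCritDiv {m : ℕ} (hm : 1 ≤ m) {e : ℕ}
    (φ : IntegralDiv closedDisk e ≃ IntegralDiv closedDisk e)
    (hφ : ∀ Z C, φ Z = C ↔ IsCritDiv m Z.points C.points) : Continuous φ ∧ Continuous φ.symm := by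
  have hg : IsClosed {p : IntegralDiv closedDisk e × IntegralDiv closedDisk e | φ p.1 = p.2} := by
    simp only [hφ, isCritDiv_iff hm (IntegralDiv.norm_le_one _), Set.ofPred_forall]
    refine isClosed_iInter fun z => isClosed_iInter fun w => isClosed_eq ?_ ?_
    all_goals
      exact ((IntegralDiv.continuous_critPoly_eval m closedDisk e _).comp continuous_fst).mul
        ((IntegralDiv.continuous_symPoly_eval closedDisk e _).comp continuous_snd)
  refine ⟨continuous_of_isClosed_graph_of_compactSpace hg,
    continuous_of_isClosed_graph_of_compactSpace ?_⟩
  convert hg.preimage continuous_swap using 1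
  ext p
  exact (Equiv.symm_apply_eq φ).trans eq_comm

theorem theorem2p2 (m : ℕ) (hm : 1 ≤ m) :
    ∃ Ψ : (d : ℕ) → IntegralDiv openDisk d ≃ₜ IntegralDiv openDisk d,
      (∀ (d : ℕ) (Z : IntegralDiv openDisk d) (q : ℂ),
        (Ψ d Z).mult q = freeRamification m (blaschke m Z) q) ∧
      ∀ e : ℕ, 1 ≤ e →
        ∃ Φ : IntegralDiv closedDisk e ≃ₜ IntegralDiv closedDisk e,
          (∀ D : IntegralDiv openDisk e, Φ D.toClosed = (Ψ e D).toClosed) ∧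
          ∀ (d₁ d₂ : ℕ) (h : d₁ + d₂ = e), 1 ≤ d₂ →
            ∀ (D₁ : IntegralDiv openDisk d₁) (D₂ : IntegralDiv unitCircle d₂),
              Φ (IntegralDiv.sum h D₁ D₂) = IntegralDiv.sum h (Ψ d₁ D₁) D₂ := by
  choose ψ hψ using exists_equiv_openDisk hm
  choose φ hφ using exists_equiv_closedDisk hm
  have hc := fun e => continuous_of_isCritDiv hm (φ e) (hφ e)
  have hcomm : ∀ e (D : IntegralDiv openDisk e), φ e D.toClosed = (ψ e D).toClosed := fun e D =>
    (hφ e _ _).2 ((hψ e D _).1 rfl)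
  have hcomm' : ∀ e (D : IntegralDiv openDisk e),
      (φ e).symm D.toClosed = ((ψ e).symm D).toClosed := fun e D => by
    rw [Equiv.symm_apply_eq, hcomm, Equiv.apply_symm_apply]
  -- Continuity of Ψ and its inverse is inherited from the compact model, since Φ and its inverse
  -- both preserve the open-disk divisors.
  have hemb := fun e => (IntegralDiv.isOpenEmbedding_toClosed e).isInducing
  refine ⟨fun d => ⟨ψ d, (hemb d).continuous_iff.2 ?_, (hemb d).continuous_iff.2 ?_⟩,
    fun d Z q => mult_eq_freeRamification hm ((hψ d Z _).1 rfl) q,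
    fun e _ => ⟨⟨φ e, (hc e).1, (hc e).2⟩, hcomm e, fun d₁ d₂ h _ D₁ D₂ => ?_⟩⟩
  · exact ((hc d).1.comp (hemb d).continuous).congr (hcomm d)
  · exact ((hc d).2.comp (hemb d).continuous).congr (hcomm' d)
  · exact (hφ e _ _).2 (((hψ d₁ D₁ _).1 rfl).add D₂.norm_eq_one)

end Main
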